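/- **Setting.** Let $d\ge 1$ be an integer and $l>0$ a real number, and put $\varepsilon=2l$. For Hermitian $d\times d$ complex matrices write $\langle A,B\rangle=\operatorname{tr}(AB)\in\mathbb R$, let $\|\cdot\|_{\mathrm{op}}$ be the Euclidean operator norm, and for $f:\mathbb R\to\mathbb R$ and an eigen-decomposition $A=\sum_i\lambda_i v_iv_i^*$ put $f(A)=\sum_i f(\lambda_i)v_iv_i^*$. Let $\Delta_{d\times d}$ (the spectraplex) be the set of Hermitian positive semidefinite $d\times d$ matrices of trace $1$. For $X\in\Delta_{d\times d}$ let $S(X\|d^{-1}I_d)=\langle X,\log X-\log(d^{-1}I_d)\rangle$ (with $0\log 0=0$) be the quantum relative entropy; $\log$ is the natural logarithm. For integers $t\ge1$ and $s\in\mathbb R$ define the exp-square potential $$\Phi_t(s)=\frac{\varepsilon}{d\sqrt t}\exp\Big(\frac{s^2}{2\varepsilon^2 t}\Big).$$ **Algorithm.** Start with $S_1=0$. In round $t=1,2,\dots$: 1. Compute $\tilde X_t=\frac1{2\varepsilon}\big[\Phi_t(S_t+\varepsilon I_d)-\Phi_t(S_t-\varepsilon I_d)\big]$, with eigen-decomposition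 $\tilde X_t=\sum_{i=1}^d\lambda_{t,i}v_{t,i}v_{t,i}^*$. 2. Predict $$X_t=\frac{\sum_{i}\max\{0,\lambda_{t,i}\}v_{t,i}v_{t,i}^*}{\sum_{i}\max\{0,\lambda_{t,i}\}};$$ if the denominator is $0$, predict an arbitrary element $X_t$ of $\Delta_{d\times d}$. 3. Receive a Hermitian loss matrix $G_t$ with $\|G_t\|_{\mathrm{op}}\le l$ and put $\bar G_t=G_t-\langle G_t,X_t\rangle I_d$. If all $\lambda_{t,i}\ge0$, put $\tilde G_t=\bar G_t$; otherwise put $\tilde G_t=\bar G_t-\min\{0,\langle\bar G_t,U_t\rangle\}U_t$, where $$U_t=\frac{\sum_i\min\{0,\lambda_{t,i}\}v_{t,i}v_{t,i}^*}{\big|\sum_i\min\{0,\lambda_{t,i}\}\big|}.$$ 4. Set $S_{t+1}=S_t-\tilde G_t$. **Theorem 4.1.** For every sequence $G_1,G_2,\dots$ of Hermitian $d\times d$ matrices with $\|G_t\|_{\mathrm{op}}\le l$, and every choice of the arbitrary elements in step 2, all predictions $X_t$ lie in $\Delta_{d\times d}$, and for all $T\ge1$ and all $X\in\Delta_{d\times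 d}$ the regret $\mathrm{Reg}_T(X)=\sum_{t=1}^T\langle G_t,X_t\rangle-\sum_{t=1}^T\langle G_t,X\rangle$ satisfies $$\mathrm{Reg}_T(X)\le 2\sqrt2\,l\sqrt{T\cdot S(X\|d^{-1}I_d)}+4\sqrt2\,l\sqrt{T\log T}+2\sqrt e\,l .$$ -/

import Mathlib

namespace MatrixLEA

noncomputable section

open scoped ComplexOrder

/-- Complex `d × d` matrices. -/
abbrev Mat (d : ℕ) := Matrix (Fin d) (Fin d) ℂ

/-- The Frobenius inner product `⟨A, B⟩ = tr (A B)` of two Hermitian matrices. The trace is real for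
Hermitian arguments; the real part only turns it into a term of type `ℝ`. -/
def frob {d : ℕ} (A B : Mat d) : ℝ := (A * B).trace.re

/-- The Euclidean operator norm. -/
def opNorm {d : ℕ} (A : Mat d) : ℝ := ‖Matrix.toEuclideanCLM (n := Fin d) (𝕜 := ℂ) A‖

/-- The spectraplex: Hermitian positive semidefinite matrices of unit trace. -/
def spectraplex (d : ℕ) : Set (Mat d) := {X | X.PosSemidef ∧ X.trace = 1}

/-- The spectral extension of `f : ℝ → ℝ` to Hermitian matrices:
`∑ i, λ i • v i (v i)ᴴ` is sent to `∑ i, f (λ i) • v i (v i)ᴴ`. -/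
def spectralMap {d : ℕ} (f : ℝ → ℝ) (A : Mat d) : Mat d := cfc f A

/-- Quantum relative entropy `S(X ‖ Y) = ⟨X, log X - log Y⟩`, for `X` positive semidefinite and `Y`
positive definite. Since `Real.log 0 = 0`, the convention `0 log 0 = 0` is built in. -/
def relEntropy {d : ℕ} (X Y : Mat d) : ℝ :=
  frob X (spectralMap Real.log X - spectralMap Real.log Y)

/-- A deterministic online algorithm. In round `t = 1, 2, …` it outputs `predict t s`, where `s` is
its current internal state, then takes in a loss matrix `G` and moves to the state `update t s G`. -/
structure OnlineAlgorithm (d : ℕ) where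
  State : Type
  init : State
  predict : ℕ → State → Mat d
  update : ℕ → State → Mat d → State

/-- Internal state after `n` rounds. The loss matrix of round `t = n + 1` is `G n`. -/
def OnlineAlgorithm.stateAfter {d : ℕ} (A : OnlineAlgorithm d) (G : ℕ → Mat d) : ℕ → A.State
  | 0 => A.init
  | n + 1 => A.update (n + 1) (A.stateAfter G n) (G n)

/-- The prediction in round `t = n + 1`; it only depends on `G 0, …, G (n - 1)`. -/
def OnlineAlgorithm.prediction {d : ℕ} (A : OnlineAlgorithm d) (G : ℕ → Mat d) (n : ℕ) : Mat d :=
  A.predict (n + 1) (A.stateAfter G n)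

/-- The regret after `T` rounds against the comparator `X`. -/
def OnlineAlgorithm.regret {d : ℕ} (A : OnlineAlgorithm d) (G : ℕ → Mat d) (T : ℕ)
    (X : Mat d) : ℝ :=
  ∑ n ∈ Finset.range T, frob (G n) (A.prediction G n) - ∑ n ∈ Finset.range T, frob (G n) X

/-- The unconstrained potential-based algorithm on Hermitian matrices, with `ε = 2 l`. Its state is
the matrix `S`, minus the sum of the past loss matrices. -/
def unconstrained (d : ℕ) (l : ℝ) (Φ : ℕ → ℝ → ℝ) : OnlineAlgorithm d where
  State := Mat d
  init := 0
  predict t S := (1 / (2 * (2 * l))) •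
    (spectralMap (Φ t) (S + (2 * l) • (1 : Mat d)) - spectralMap (Φ t) (S - (2 * l) • (1 : Mat d)))
  update _ S G := S - G

/-- `∑ i, max 0 (λ i) • v i (v i)ᴴ`. -/
def posSpec {d : ℕ} (A : Mat d) : Mat d := spectralMap (fun x => max 0 x) A

/-- `∑ i, min 0 (λ i) • v i (v i)ᴴ`. -/
def negSpec {d : ℕ} (A : Mat d) : Mat d := spectralMap (fun x => min 0 x) A

/-- The sum of the eigenvalues of a Hermitian matrix, as a real number. -/
def reTrace {d : ℕ} (A : Mat d) : ℝ := A.trace.re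

open Classical in
/-- The prediction made from the base prediction `Xt`: its positive part divided by the trace of that
positive part. If this is `0 / 0`, the prediction is `F` instead. -/
def normalizedPos {d : ℕ} (F Xt : Mat d) : Mat d :=
  if reTrace (posSpec Xt) = 0 then F else (reTrace (posSpec Xt))⁻¹ • posSpec Xt

/-- `G - ⟨G, X⟩ I`. -/
def centeredLoss {d : ℕ} (X G : Mat d) : Mat d := G - frob G X • (1 : Mat d)

/-- The negative part, divided by the absolute value of its trace. -/
def negDirection {d : ℕ} (Xt : Mat d) : Mat d := |reTrace (negSpec Xt)|⁻¹ • negSpec Xt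

open Classical in
/-- The surrogate loss matrix sent to the base algorithm whose prediction was `Xt`, when the actual
prediction is `X` and the actual loss matrix is `G`. -/
def surrogateLoss {d : ℕ} (Xt X G : Mat d) : Mat d :=
  if Xt.PosSemidef then centeredLoss X G
  else centeredLoss X G - min 0 (frob (centeredLoss X G) (negDirection Xt)) • negDirection Xt

/-- The reduction from the spectraplex to all Hermitian matrices. The matrix `F t` is the prediction
of round `t` when the positive part of the base prediction vanishes. -/
def reduction {d : ℕ} (A : OnlineAlgorithm d) (F : ℕ → Mat d) : OnlineAlgorithm d where
  State := A.State
  init := A.init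
  predict t s := normalizedPos (F t) (A.predict t s)
  update t s G := A.update t s
    (surrogateLoss (A.predict t s) (normalizedPos (F t) (A.predict t s)) G)

/-- The exp-square potential, with `ε = 2 l`. -/
def expSq (d : ℕ) (l : ℝ) (t : ℕ) (s : ℝ) : ℝ :=
  (2 * l) / (d * √(t : ℝ)) * Real.exp (s ^ 2 / (2 * (2 * l) ^ 2 * t))

end

end MatrixLEA

namespace MatrixLEA

open scoped ComplexOrder
open Matrix MeasureTheory

variable {d : ℕ} {A B : Mat d}

/-! Write ε = 2l and a = tε²/2. Up to a positive factor, the exp-square potential is the full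
Gaussian Laplace transform `fullGaussian`. The analysis tracks the trace of its half z > 0,
`halfPotential`. The surrogate loss is orthogonal to the positive part of the base prediction only,
and up to a bounded error that positive part is proportional to the symmetric difference of the half
transform (`halfSlope_sub_max_mem`).

One step rests on `trace_exp_add_le`, a matrix form of bounding the exponential by its chord on [-ε,
ε]. Integrated over z > 0, it bounds the new potential by an average over shifts by ±ε minus a
linear term, which orthogonality nearly cancels. Since cosh(zε) ≤ exp(z²ε²/2), raising a by ε²/2
absorbs the average. The potential therefore grows at most linearly in T
(`halfPotential_stateMatrix_le`).

Hence the trace of exp(S₊²/(2ε²T)) is at most dT⁴ for T ≥ 2. The regret is at most ⟨S, X⟩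
(`regret_le_frob_stateMatrix`), and Cauchy–Schwarz with the Gibbs variational inequality
(`frob_le_sqrt_entropy`) turns the trace bound into the entropy bound. -/

/-! ### Functional calculus and double spectral sums. -/

theorem cfc_eq_conj (hA : A.IsHermitian) (f : ℝ → ℝ) :
    cfc f A = (hA.eigenvectorUnitary : Mat d) *
      diagonal (fun i => (f (hA.eigenvalues i) : ℂ)) * star (hA.eigenvectorUnitary : Mat d) := by
  rw [hA.cfc_eq, Matrix.IsHermitian.cfc, Unitary.conjStarAlgAut_apply]
  rfl

/-- The spectrum is finite, so the calculus rules below need no continuity assumption on the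
functions. -/
theorem continuousOn_spectrum (f : ℝ → ℝ) : ContinuousOn f (spectrum ℝ A) :=
  (Matrix.finite_real_spectrum).continuousOn f

theorem cfc_id_eq (hA : A.IsHermitian) : cfc (fun x : ℝ => x) A = A :=
  cfc_id' ℝ A hA

theorem cfc_one_eq (hA : A.IsHermitian) : cfc (fun _ : ℝ => (1 : ℝ)) A = 1 :=
  cfc_const_one ℝ A hA

theorem cfc_mul_eq (f g : ℝ → ℝ) : cfc f A * cfc g A = cfc (fun x => f x * g x) A :=
  (cfc_mul f g A (continuousOn_spectrum f) (continuousOn_spectrum g)).symm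

theorem cfc_sub_eq (f g : ℝ → ℝ) : cfc f A - cfc g A = cfc (fun x => f x - g x) A :=
  (cfc_sub f g A (continuousOn_spectrum f) (continuousOn_spectrum g)).symm

theorem cfc_const_eq (hA : A.IsHermitian) (r : ℝ) : cfc (fun _ : ℝ => r) A = r • (1 : Mat d) :=
  (cfc_const r A hA).trans (Algebra.algebraMap_eq_smul_one r)

theorem cfc_comp_eq (hA : A.IsHermitian) (g f : ℝ → ℝ) :
    cfc g (cfc f A) = cfc (fun x => g (f x)) A :=
  (cfc_comp' g f A (((Matrix.finite_real_spectrum).image f).continuousOn g)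
    (continuousOn_spectrum f) hA).symm

theorem isHermitian_cfc (f : ℝ → ℝ) : (cfc f A).IsHermitian := cfc_predicate f A

theorem posSemidef_cfc (hA : A.IsHermitian) {f : ℝ → ℝ} (hf : ∀ i, 0 ≤ f (hA.eigenvalues i)) :
    (cfc f A).PosSemidef := by
  rw [cfc_eq_conj hA]
  refine PosSemidef.mul_mul_conjTranspose_same (PosSemidef.diagonal fun i => ?_) _
  simpa using hf i

/-- Squared moduli of the inner products of the eigenvectors of two Hermitian matrices. -/
noncomputable def overlap (hA : A.IsHermitian) (hB : B.IsHermitian) (i j : Fin d) : ℝ :=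
  Complex.normSq ((star (hA.eigenvectorUnitary : Mat d) * (hB.eigenvectorUnitary : Mat d)) i j)

theorem overlap_nonneg (hA : A.IsHermitian) (hB : B.IsHermitian) (i j : Fin d) :
    0 ≤ overlap hA hB i j := Complex.normSq_nonneg _

theorem frob_comm (A B : Mat d) : frob A B = frob B A := by
  unfold frob; rw [trace_mul_comm]

theorem frob_add_left (A B C : Mat d) : frob (A + B) C = frob A C + frob B C := by
  simp [frob, add_mul]

theorem frob_sub_left (A B C : Mat d) : frob (A - B) C = frob A C - frob B C := by
  simp [frob, sub_mul]

theorem frob_neg_left (A B : Mat d) : frob (-A) B = - frob A B := by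
  simp [frob]

theorem frob_smul_left (r : ℝ) (A B : Mat d) : frob (r • A) B = r * frob A B := by
  simp [frob]

theorem frob_sub_right (A B C : Mat d) : frob A (B - C) = frob A B - frob A C := by
  simp [frob, mul_sub]

theorem frob_smul_right (r : ℝ) (A B : Mat d) : frob A (r • B) = r * frob A B := by
  simp [frob]

theorem frob_one_right (A : Mat d) : frob A 1 = A.trace.re := by simp [frob]

theorem frob_one_left (A : Mat d) : frob 1 A = A.trace.re := by simp [frob]

/-- The weights are nonnegative, so a scalar inequality in a pair of eigenvalues becomes a trace
inequality for noncommuting matrices. -/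
theorem frob_cfc_cfc (hA : A.IsHermitian) (hB : B.IsHermitian) (f g : ℝ → ℝ) :
    frob (cfc f A) (cfc g B) =
      ∑ i, ∑ j, overlap hA hB i j * (f (hA.eigenvalues i) * g (hB.eigenvalues j)) := by
  set U : Mat d := (hA.eigenvectorUnitary : Mat d)
  set V : Mat d := (hB.eigenvectorUnitary : Mat d)
  set D := diagonal (fun i => (f (hA.eigenvalues i) : ℂ)) with hD
  set E := diagonal (fun i => (g (hB.eigenvalues i) : ℂ)) with hE
  have h : (cfc f A * cfc g B).trace = (D * (star U * V) * (E * star (star U * V))).trace := by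
    rw [cfc_eq_conj hA, cfc_eq_conj hB]
    change ((U * D * star U) * (V * E * star V)).trace = _
    rw [Matrix.mul_assoc U, Matrix.mul_assoc U, trace_mul_comm U, star_mul, star_star]
    simp only [Matrix.mul_assoc]
  rw [frob, h]
  simp only [trace, diag_apply, Complex.re_sum]
  refine Finset.sum_congr rfl fun i _ => ?_
  rw [Matrix.mul_apply, Complex.re_sum]
  refine Finset.sum_congr rfl fun j _ => ?_
  rw [hD, hE, diagonal_mul, diagonal_mul, star_apply, overlap]
  change _ = Complex.normSq ((star U * V) i j) * _
  rw [Complex.normSq_apply]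
  simp [Complex.mul_re, Complex.mul_im]
  ring

theorem trace_cfc (hA : A.IsHermitian) (f : ℝ → ℝ) :
    (cfc f A).trace.re = ∑ i, f (hA.eigenvalues i) := by
  rw [cfc_eq_conj hA, trace_mul_cycle, Unitary.coe_star_mul_self, one_mul, trace_diagonal]
  simp

theorem sum_overlap_left (hA : A.IsHermitian) (hB : B.IsHermitian) (f : ℝ → ℝ) :
    ∑ i, ∑ j, overlap hA hB i j * f (hA.eigenvalues i) = ∑ i, f (hA.eigenvalues i) := by
  have := frob_cfc_cfc hA hB f (fun _ => 1)
  rw [cfc_one_eq hB, frob_one_right, trace_cfc hA] at this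
  simpa using this.symm

theorem sum_overlap_right (hA : A.IsHermitian) (hB : B.IsHermitian) (f : ℝ → ℝ) :
    ∑ i, ∑ j, overlap hA hB i j * f (hB.eigenvalues j) = ∑ i, f (hB.eigenvalues i) := by
  have := frob_cfc_cfc hA hB (fun _ => 1) f
  rw [cfc_one_eq hA, frob_one_left, trace_cfc hB] at this
  simpa using this.symm

theorem frob_nonneg (hA : A.PosSemidef) (hB : B.PosSemidef) : 0 ≤ frob A B := by
  have := frob_cfc_cfc hA.1 hB.1 (fun x => x) (fun x => x)
  rw [cfc_id_eq hA.1, cfc_id_eq hB.1] at this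
  rw [this]
  exact Finset.sum_nonneg fun i _ => Finset.sum_nonneg fun j _ =>
    mul_nonneg (overlap_nonneg ..) (mul_nonneg (hA.eigenvalues_nonneg i) (hB.eigenvalues_nonneg j))

/-- The diagonal entries of `B` in the eigenbasis of `A`. -/
noncomputable def eigenDiag (hA : A.IsHermitian) (B : Mat d) (i : Fin d) : ℝ :=
  ((star (hA.eigenvectorUnitary : Mat d) * B * (hA.eigenvectorUnitary : Mat d)) i i).re

theorem eigenDiag_add (hA : A.IsHermitian) (B C : Mat d) (i : Fin d) :
    eigenDiag hA (B + C) i = eigenDiag hA B i + eigenDiag hA C i := by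
  simp [eigenDiag, mul_add, add_mul]

theorem eigenDiag_sub (hA : A.IsHermitian) (B C : Mat d) (i : Fin d) :
    eigenDiag hA (B - C) i = eigenDiag hA B i - eigenDiag hA C i := by
  simp [eigenDiag, mul_sub, sub_mul]

theorem eigenDiag_smul_one (hA : A.IsHermitian) (r : ℝ) (i : Fin d) :
    eigenDiag hA (r • (1 : Mat d)) i = r := by
  simp [eigenDiag]

theorem eigenDiag_nonneg (hA : A.IsHermitian) (hB : B.PosSemidef) (i : Fin d) :
    0 ≤ eigenDiag hA B i :=
  (Complex.le_def.1 (hB.conjTranspose_mul_mul_same (hA.eigenvectorUnitary : Mat d)).diag_nonneg).1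

theorem eigenDiag_self (hA : A.IsHermitian) (i : Fin d) :
    eigenDiag hA A i = hA.eigenvalues i := by
  have h := hA.conjStarAlgAut_star_eigenvectorUnitary
  rw [Unitary.conjStarAlgAut_star_apply] at h
  rw [eigenDiag]
  refine (congrArg (fun M : Mat d => (M i i).re) h).trans ?_
  simp

theorem eigenvalues_le (hA : A.IsHermitian) {r : ℝ} (h : (r • (1 : Mat d) - A).PosSemidef)
    (i : Fin d) : hA.eigenvalues i ≤ r := by
  have := eigenDiag_nonneg hA h i
  rw [eigenDiag_sub, eigenDiag_smul_one, eigenDiag_self] at this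
  linarith

theorem neg_le_eigenvalues (hA : A.IsHermitian) {r : ℝ} (h : (r • (1 : Mat d) + A).PosSemidef)
    (i : Fin d) : -r ≤ hA.eigenvalues i := by
  have := eigenDiag_nonneg hA h i
  rw [eigenDiag_add, eigenDiag_smul_one, eigenDiag_self] at this
  linarith

theorem frob_cfc_right (hA : A.IsHermitian) (B : Mat d) (f : ℝ → ℝ) :
    frob B (cfc f A) = ∑ i, f (hA.eigenvalues i) * eigenDiag hA B i := by
  rw [frob, cfc_eq_conj hA, ← Matrix.mul_assoc, ← Matrix.mul_assoc, trace_mul_comm,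
    ← Matrix.mul_assoc, ← Matrix.mul_assoc]
  simp only [trace, diag_apply, mul_diagonal, Complex.re_sum, eigenDiag]
  refine Finset.sum_congr rfl fun i _ => ?_
  rw [Complex.re_mul_ofReal, mul_comm]

/-! ### Growth of the trace exponential along a line. -/

theorem cfc_exp_eq (hA : A.IsHermitian) : cfc Real.exp A = NormedSpace.exp A := by
  have hu : IsUnit (hA.eigenvectorUnitary : Mat d) :=
    (Unitary.toUnits hA.eigenvectorUnitary).isUnit
  have hinv : (hA.eigenvectorUnitary : Mat d)⁻¹ = star (hA.eigenvectorUnitary : Mat d) :=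
    Matrix.inv_eq_left_inv (Unitary.coe_star_mul_self _)
  conv_rhs => rw [← cfc_id_eq hA, cfc_eq_conj hA, ← hinv, Matrix.exp_conj _ _ hu,
    Matrix.exp_diagonal]
  rw [cfc_eq_conj hA, hinv]
  congr 3
  ext i
  rw [Pi.coe_exp, ← Complex.exp_eq_exp_ℂ, Complex.ofReal_exp]

/-- Klein's inequality for the exponential. -/
theorem klein_exp (hA : A.IsHermitian) (hB : B.IsHermitian) :
    frob (B - A) (cfc Real.exp A) ≤ (cfc Real.exp B).trace.re - (cfc Real.exp A).trace.re := by
  have h1 := frob_cfc_cfc hA hB Real.exp (fun x => x)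
  have h2 := cfc_mul_eq (A := A) (fun x => x) Real.exp
  rw [cfc_id_eq hA] at h2
  rw [cfc_id_eq hB] at h1
  rw [frob_sub_left, frob_comm B, h1, frob, h2, trace_cfc hA, trace_cfc hA, trace_cfc hB,
    ← sum_overlap_left hA hB Real.exp, ← sum_overlap_left hA hB fun x => x * Real.exp x,
    ← sum_overlap_right hA hB]
  simp only [← Finset.sum_sub_distrib]
  refine Finset.sum_le_sum fun i _ => Finset.sum_le_sum fun j _ => ?_
  simp only [← mul_sub]
  refine mul_le_mul_of_nonneg_left ?_ (overlap_nonneg hA hB i j)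
  have := Real.add_one_le_exp (hB.eigenvalues j - hA.eigenvalues i)
  rw [Real.exp_sub, le_div_iff₀ (Real.exp_pos _)] at this
  linarith

theorem sinh_le_mul_cosh {u : ℝ} (hu : 0 ≤ u) : Real.sinh u ≤ u * Real.cosh u := by
  have hm : MonotoneOn (fun x : ℝ => x * Real.cosh x - Real.sinh x) (Set.Ici 0) := by
    refine monotoneOn_of_deriv_nonneg (convex_Ici 0) (by fun_prop) (by fun_prop) fun x hx => ?_
    have h : HasDerivAt (fun x : ℝ => x * Real.cosh x - Real.sinh x)
        (1 * Real.cosh x + x * Real.sinh x - Real.cosh x) x :=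
      ((hasDerivAt_id x).mul (Real.hasDerivAt_cosh x)).sub (Real.hasDerivAt_sinh x)
    rw [h.deriv]
    rw [interior_Ici] at hx
    have := mul_nonneg (le_of_lt hx) (Real.sinh_nonneg_iff.2 (le_of_lt hx))
    linarith
  have := hm (Set.self_mem_Ici) hu hu
  simp at this
  linarith

/-- With exp((x + y)/2) factored out, this is sinh u ≤ u cosh u at u = (y - x)/2: the logarithmic
mean of the two exponentials is at most their arithmetic mean. -/
theorem sub_mul_exp_sub_le (x y : ℝ) :
    (y - x) * (Real.exp y - Real.exp x) ≤ (y - x) ^ 2 * (Real.exp x + Real.exp y) / 2 := by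
  wlog h : x ≤ y generalizing x y
  · linarith [this y x (le_of_not_ge h)]
  have hs := sinh_le_mul_cosh (u := (y - x) / 2) (by linarith)
  have ey : Real.exp y = Real.exp ((x + y) / 2) * Real.exp ((y - x) / 2) := by
    rw [← Real.exp_add]; ring_nf
  have ex : Real.exp x = Real.exp ((x + y) / 2) * Real.exp (-((y - x) / 2)) := by
    rw [← Real.exp_add]; ring_nf
  have h1 : Real.exp y - Real.exp x = 2 * Real.exp ((x + y) / 2) * Real.sinh ((y - x) / 2) := by
    rw [ex, ey, Real.sinh_eq]; ring
  have h2 : Real.exp x + Real.exp y = 2 * Real.exp ((x + y) / 2) * Real.cosh ((y - x) / 2) := by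
    rw [ex, ey, Real.cosh_eq]; ring
  rw [h1, h2]
  have := mul_le_mul_of_nonneg_left hs
    (show 0 ≤ (y - x) * (2 * Real.exp ((x + y) / 2)) from
      mul_nonneg (by linarith) (by positivity))
  linarith

/-- The scalar inequality `sub_mul_exp_sub_le`, weighted by the overlaps. It controls the second
derivative of the trace exponential through finite differences of the first. -/
theorem frob_sub_cfc_exp_sub_le (hA : A.IsHermitian) (hB : B.IsHermitian) :
    frob (B - A) (cfc Real.exp B - cfc Real.exp A) ≤
      (frob ((B - A) * (B - A)) (cfc Real.exp A) + frob ((B - A) * (B - A)) (cfc Real.exp B)) / 2 := by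
  set P := overlap hA hB
  set a := hA.eigenvalues
  set b := hB.eigenvalues
  have key (f g : ℝ → ℝ) := frob_cfc_cfc hA hB f g
  have hAA : cfc (fun x : ℝ => x) A = A := cfc_id_eq hA
  have hBB : cfc (fun x : ℝ => x) B = B := cfc_id_eq hB
  have hA1 : cfc (fun _ : ℝ => (1 : ℝ)) A = 1 := cfc_one_eq hA
  have hB1 : cfc (fun _ : ℝ => (1 : ℝ)) B = 1 := cfc_one_eq hB
  have e1 : frob (B - A) (cfc Real.exp B - cfc Real.exp A) =
      ∑ i, ∑ j, P i j * ((b j - a i) * (Real.exp (b j) - Real.exp (a i))) := by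
    have h1 := key (fun _ => 1) (fun x => x * Real.exp x)
    have h2 := key (fun x => x) Real.exp
    have h3 := key Real.exp (fun x => x)
    have h4 := key (fun x => x * Real.exp x) (fun _ => 1)
    rw [← cfc_mul_eq, hA1, hBB] at h1
    rw [hAA] at h2
    rw [hBB] at h3
    rw [← cfc_mul_eq, hB1, hAA] at h4
    have : frob (B - A) (cfc Real.exp B - cfc Real.exp A) =
      frob 1 (B * cfc Real.exp B) - frob A (cfc Real.exp B) - frob (cfc Real.exp A) B
        + frob (A * cfc Real.exp A) 1 := by
      rw [frob_comm (cfc Real.exp A) B]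
      simp [frob, sub_mul, mul_sub]; ring
    rw [this, h1, h2, h3, h4]
    simp only [← Finset.sum_sub_distrib, ← Finset.sum_add_distrib]
    refine Finset.sum_congr rfl fun i _ => Finset.sum_congr rfl fun j _ => ?_
    ring
  have e2 : frob ((B - A) * (B - A)) (cfc Real.exp A) =
      ∑ i, ∑ j, P i j * ((b j - a i) ^ 2 * Real.exp (a i)) := by
    have h1 := key Real.exp (fun x => x * x)
    have h2 := key (fun x => x * Real.exp x) (fun x => x)
    have h4 := key (fun x => x * x * Real.exp x) (fun _ => 1)
    have h5 := key (fun x => Real.exp x * x) (fun x => x)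
    rw [← cfc_mul_eq, hBB] at h1
    rw [← cfc_mul_eq, hBB, hAA] at h2
    rw [← cfc_mul_eq, ← cfc_mul_eq, hB1, hAA] at h4
    rw [← cfc_mul_eq, hBB, hAA] at h5
    have : frob ((B - A) * (B - A)) (cfc Real.exp A) =
      frob (cfc Real.exp A) (B * B) - frob (A * cfc Real.exp A) B - frob (cfc Real.exp A * A) B
        + frob (A * A * cfc Real.exp A) 1 := by
      rw [frob_comm _ (B * B), frob_comm (A * _) B, frob_comm (_ * A) B]
      have : (B * (cfc Real.exp A * A)).trace = (A * B * cfc Real.exp A).trace := by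
        rw [← mul_assoc, trace_mul_comm, ← mul_assoc]
      simp only [frob, this]
      simp [sub_mul, mul_sub, mul_assoc]; ring
    rw [this, h1, h2, h4, h5]
    simp only [← Finset.sum_sub_distrib, ← Finset.sum_add_distrib]
    refine Finset.sum_congr rfl fun i _ => Finset.sum_congr rfl fun j _ => ?_
    ring
  have e3 : frob ((B - A) * (B - A)) (cfc Real.exp B) =
      ∑ i, ∑ j, P i j * ((b j - a i) ^ 2 * Real.exp (b j)) := by
    have h1 := key (fun x => x * x) Real.exp
    have h2 := key (fun x => x) (fun x => x * Real.exp x)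
    have h4 := key (fun _ => 1) (fun x => x * x * Real.exp x)
    have h5 := key (fun x => x) (fun x => Real.exp x * x)
    rw [← cfc_mul_eq, hAA] at h1
    rw [← cfc_mul_eq, hBB, hAA] at h2
    rw [← cfc_mul_eq, ← cfc_mul_eq, hA1, hBB] at h4
    rw [← cfc_mul_eq, hBB, hAA] at h5
    have : frob ((B - A) * (B - A)) (cfc Real.exp B) =
      frob (A * A) (cfc Real.exp B) - frob A (B * cfc Real.exp B) - frob A (cfc Real.exp B * B)
        + frob 1 (B * B * cfc Real.exp B) := by
      have : (A * (cfc Real.exp B * B)).trace = (B * A * cfc Real.exp B).trace := by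
        rw [← mul_assoc, trace_mul_comm, ← mul_assoc]
      simp only [frob, this]
      simp [sub_mul, mul_sub, mul_assoc]; ring
    rw [this, h1, h2, h4, h5]
    simp only [← Finset.sum_sub_distrib, ← Finset.sum_add_distrib]
    refine Finset.sum_congr rfl fun i _ => Finset.sum_congr rfl fun j _ => ?_
    ring
  rw [e1, e2, e3, ← Finset.sum_add_distrib, Finset.sum_div]
  refine Finset.sum_le_sum fun i _ => ?_
  rw [← Finset.sum_add_distrib, Finset.sum_div]
  refine Finset.sum_le_sum fun j _ => ?_
  have := mul_le_mul_of_nonneg_left (sub_mul_exp_sub_le (a i) (b j)) (overlap_nonneg hA hB i j)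
  refine this.trans (le_of_eq ?_)
  change P i j * _ = _
  ring

section exponential

open scoped Matrix.Norms.L2Operator

theorem differentiable_exp_line (A B : Mat d) :
    Differentiable ℝ fun θ : ℝ => NormedSpace.exp (A + θ • B) := by
  intro θ
  have h : DifferentiableAt ℝ (NormedSpace.exp : Mat d → Mat d) (A + θ • B) :=
    (NormedSpace.exp_analytic (𝕂 := ℝ) (A + θ • B)).differentiableAt
  exact h.comp θ (by fun_prop)

theorem differentiable_frob_exp_line (A B C : Mat d) :
    Differentiable ℝ fun θ : ℝ => frob C (NormedSpace.exp (A + θ • B)) := by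
  have h := differentiable_exp_line A B
  let L : Mat d →ₗ[ℝ] ℝ :=
    { toFun := fun M => frob C M
      map_add' := fun M N => by simp [frob, mul_add]
      map_smul' := fun r M => by simp [frob] }
  exact (LinearMap.toContinuousLinearMap L).differentiable.comp h

end exponential

theorem frob_mul_self_le {ε : ℝ} (hB : B.IsHermitian) (hε : (ε • (1 : Mat d) - B).PosSemidef)
    (hε' : (ε • (1 : Mat d) + B).PosSemidef) (hA : A.PosSemidef) :
    frob (B * B) A ≤ ε ^ 2 * frob 1 A := by
  have h : (cfc (fun x => ε ^ 2 - x * x) B).PosSemidef := posSemidef_cfc hB fun i => by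
    have h1 := eigenvalues_le hB hε i
    have h2 := neg_le_eigenvalues hB hε' i
    nlinarith
  rw [← cfc_sub_eq, ← cfc_mul_eq, cfc_id_eq hB, cfc_const_eq hB] at h
  have := frob_nonneg h hA
  rw [frob_sub_left, frob_smul_left] at this
  linarith

/-- The trace exponential on the line `A + θ B` grows at most like the solution of
`φ'' = ε ^ 2 φ` with the same initial data, where `ε` bounds `B`. -/
theorem trace_exp_add_le {ε : ℝ} (hε0 : 0 ≤ ε) (hA : A.IsHermitian) (hB : B.IsHermitian)
    (hε : (ε • (1 : Mat d) - B).PosSemidef) (hε' : (ε • (1 : Mat d) + B).PosSemidef) :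
    ε * frob 1 (cfc Real.exp (A + B)) ≤
      ε * Real.cosh ε * frob 1 (cfc Real.exp A) + Real.sinh ε * frob B (cfc Real.exp A) := by
  have hC (θ : ℝ) : (A + θ • B).IsHermitian := hA.add (by
    rw [IsHermitian, conjTranspose_smul, hB.eq, star_trivial])
  set φ : ℝ → ℝ := fun θ => frob 1 (NormedSpace.exp (A + θ • B)) with hφ
  set ψ : ℝ → ℝ := fun θ => frob B (NormedSpace.exp (A + θ • B)) with hψ
  have dφ : Differentiable ℝ φ := differentiable_frob_exp_line A B 1
  have dψ : Differentiable ℝ ψ := differentiable_frob_exp_line A B B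
  have hdiff (a b : ℝ) : (A + b • B) - (A + a • B) = (b - a) • B := by
    rw [sub_smul]; abel
  have klein (a b : ℝ) : (b - a) * ψ a ≤ φ b - φ a := by
    have := klein_exp (hC a) (hC b)
    rw [hdiff, frob_smul_left, cfc_exp_eq (hC a), cfc_exp_eq (hC b), ← frob_one_left,
      ← frob_one_left] at this
    exact this
  -- By Klein's inequality, φ b - (b - a) ψ a is minimal at b = a, so its derivative vanishes there.
  have hφ' (a : ℝ) : HasDerivAt φ (ψ a) a := by
    have h1 : HasDerivAt (fun b => φ b - (b - a) * ψ a) (deriv φ a - 1 * ψ a) a :=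
      (dφ a).hasDerivAt.sub (((hasDerivAt_id a).sub_const a).mul_const _)
    have h2 : IsLocalMin (fun b => φ b - (b - a) * ψ a) a :=
      Filter.Eventually.of_forall fun b => by
        have := klein a b
        simp only [sub_self, zero_mul, sub_zero]
        linarith
    have h3 := h2.hasDerivAt_eq_zero h1
    have h4 : deriv φ a = ψ a := by linarith
    exact h4 ▸ (dφ a).hasDerivAt
  have psd (a : ℝ) : (cfc Real.exp (A + a • B)).PosSemidef :=
    posSemidef_cfc (hC a) fun i => (Real.exp_pos _).le
  have second (a b : ℝ) : (b - a) * (ψ b - ψ a) ≤ (b - a) ^ 2 * (ε ^ 2 * (φ a + φ b) / 2) := by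
    have h1 := frob_sub_cfc_exp_sub_le (hC a) (hC b)
    have ha := frob_mul_self_le hB hε hε' (psd a)
    have hb := frob_mul_self_le hB hε hε' (psd b)
    rw [hdiff, smul_mul_smul_comm, frob_smul_left, frob_smul_left, frob_smul_left,
      frob_sub_right] at h1
    rw [cfc_exp_eq (hC a)] at h1 ha
    rw [cfc_exp_eq (hC b)] at h1 hb
    have := mul_le_mul_of_nonneg_left (add_le_add ha hb) (sq_nonneg (b - a))
    simp only [hφ, hψ]
    nlinarith
  -- Divide `second` by (b - a)² and let b decrease to a.
  have hψ' (a : ℝ) : deriv ψ a ≤ ε ^ 2 * φ a := by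
    have h1 := (hasDerivWithinAt_iff_tendsto_slope' (Set.self_notMem_Ioi (a := a))).1
      (dψ a).hasDerivAt.hasDerivWithinAt
    have h2 : Filter.Tendsto (fun b => ε ^ 2 * (φ a + φ b) / 2) (nhdsWithin a (Set.Ioi a))
        (nhds (ε ^ 2 * (φ a + φ a) / 2)) :=
      ((((hφ' a).continuousAt.tendsto.const_add _).const_mul _).div_const _).mono_left
        nhdsWithin_le_nhds
    refine (le_of_tendsto_of_tendsto h1 h2 ?_).trans (le_of_eq (by ring))
    filter_upwards [self_mem_nhdsWithin] with b hb
    have hb' : 0 < b - a := sub_pos.2 hb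
    rw [slope_def_field, div_le_iff₀ hb']
    have := second a b
    refine le_of_mul_le_mul_left (this.trans (le_of_eq ?_)) hb'
    ring
  -- This Wronskian-type quantity has derivative (ψ' - ε²φ) sinh(ε(1 - θ)) ≤ 0; its values at 0 and
  -- 1 are the two sides of the claim.
  have anti : AntitoneOn (fun θ => φ θ * (ε * Real.cosh (ε * (1 - θ)))
      + ψ θ * Real.sinh (ε * (1 - θ))) (Set.Icc 0 1) := by
    have hd (θ : ℝ) : HasDerivAt (fun θ => φ θ * (ε * Real.cosh (ε * (1 - θ)))
        + ψ θ * Real.sinh (ε * (1 - θ)))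
        (ψ θ * (ε * Real.cosh (ε * (1 - θ))) + φ θ * (ε * (Real.sinh (ε * (1 - θ)) * (ε * (-1))))
          + (deriv ψ θ * Real.sinh (ε * (1 - θ))
            + ψ θ * (Real.cosh (ε * (1 - θ)) * (ε * (-1))))) θ := by
      have hl : HasDerivAt (fun θ : ℝ => ε * (1 - θ)) (ε * (-1)) θ :=
        ((hasDerivAt_id θ).const_sub 1).const_mul ε
      exact ((hφ' θ).mul (hl.cosh.const_mul ε)).add ((dψ θ).hasDerivAt.mul hl.sinh)
    refine antitoneOn_of_deriv_nonpos (convex_Icc 0 1)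
      (fun θ _ => (hd θ).continuousAt.continuousWithinAt)
      (fun θ _ => (hd θ).differentiableAt.differentiableWithinAt) fun θ hθ => ?_
    rw [(hd θ).deriv]
    rw [interior_Icc] at hθ
    have hs : 0 ≤ Real.sinh (ε * (1 - θ)) :=
      Real.sinh_nonneg_iff.2 (mul_nonneg hε0 (by linarith [hθ.2]))
    have := mul_le_mul_of_nonneg_right (hψ' θ) hs
    nlinarith
  have h01 := anti (Set.left_mem_Icc.2 zero_le_one) (Set.right_mem_Icc.2 zero_le_one) zero_le_one
  have hAB : (A + B).IsHermitian := hA.add hB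
  simp only [hφ, hψ, sub_self, mul_zero, Real.cosh_zero, Real.sinh_zero, zero_smul, add_zero,
    one_smul, mul_one, sub_zero] at h01
  rw [cfc_exp_eq hAB, cfc_exp_eq hA]
  linarith

/-! ### Scalar estimates for the one-sided Gaussian potential. -/

section halfGaussian

/-- The Laplace transform of the restriction of a Gaussian weight to the positive half-line. -/
noncomputable def halfGaussian (a s : ℝ) : ℝ :=
  ∫ z in Set.Ioi (0 : ℝ), Real.exp (z * s - a * z ^ 2)

/-- The Laplace transform of a Gaussian weight, in closed form. -/
noncomputable def fullGaussian (a s : ℝ) : ℝ := √(Real.pi / a) * Real.exp (s ^ 2 / (4 * a))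

variable {a : ℝ}

theorem exp_quadratic_eq (ha : 0 < a) (s z : ℝ) :
    Real.exp (z * s - a * z ^ 2) =
      Real.exp (s ^ 2 / (4 * a)) * Real.exp (-a * (z - s / (2 * a)) ^ 2) := by
  rw [← Real.exp_add]
  congr 1
  field_simp
  ring

theorem integrable_exp_quadratic (ha : 0 < a) (s : ℝ) :
    Integrable fun z : ℝ => Real.exp (z * s - a * z ^ 2) := by
  simp_rw [exp_quadratic_eq ha]
  exact ((integrable_exp_neg_mul_sq ha).comp_sub_right (s / (2 * a))).const_mul _

theorem integral_exp_quadratic (ha : 0 < a) (s : ℝ) :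
    ∫ z : ℝ, Real.exp (z * s - a * z ^ 2) = fullGaussian a s := by
  simp_rw [exp_quadratic_eq ha]
  rw [integral_const_mul, integral_sub_right_eq_self (fun z : ℝ => Real.exp (-a * z ^ 2)),
    integral_gaussian, fullGaussian, mul_comm]

theorem halfGaussian_nonneg (a s : ℝ) : 0 ≤ halfGaussian a s :=
  integral_nonneg fun _ => (Real.exp_pos _).le

theorem halfGaussian_add_neg (ha : 0 < a) (s : ℝ) :
    halfGaussian a s + halfGaussian a (-s) = fullGaussian a s := by
  have hi := integrable_exp_quadratic ha s
  have h : halfGaussian a (-s) = ∫ z in Set.Iic (0 : ℝ), Real.exp (z * s - a * z ^ 2) := by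
    have := integral_comp_neg_Ioi (0 : ℝ) fun z => Real.exp (z * s - a * z ^ 2)
    rw [neg_zero] at this
    rw [← this, halfGaussian]
    refine integral_congr_ae (Filter.Eventually.of_forall fun z => ?_)
    simp
  rw [h, add_comm, halfGaussian, ← integral_exp_quadratic ha]
  exact intervalIntegral.integral_Iic_add_Ioi hi.integrableOn hi.integrableOn

theorem fullGaussian_le_two_mul_halfGaussian (ha : 0 < a) {s : ℝ} (hs : 0 ≤ s) :
    fullGaussian a s ≤ 2 * halfGaussian a s := by
  have h : halfGaussian a (-s) ≤ halfGaussian a s := by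
    refine setIntegral_mono_on (integrable_exp_quadratic ha _).integrableOn
      (integrable_exp_quadratic ha s).integrableOn measurableSet_Ioi fun z hz =>
        Real.exp_le_exp.2 ?_
    have := mul_nonneg (le_of_lt hz) hs
    linarith
  linarith [halfGaussian_add_neg ha s]

/-- Averaging the shifts multiplies the integrand by cosh(zε) ≤ exp(z²ε²/2), which the heavier
Gaussian damping cancels. -/
theorem halfGaussian_average_le (ha : 0 < a) (ε s : ℝ) :
    halfGaussian (a + ε ^ 2 / 2) (s + ε) + halfGaussian (a + ε ^ 2 / 2) (s - ε) ≤
      2 * halfGaussian a s := by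
  have hb : 0 < a + ε ^ 2 / 2 := by positivity
  rw [halfGaussian, halfGaussian, halfGaussian, ← integral_const_mul,
    ← integral_add (integrable_exp_quadratic hb _).integrableOn
      (integrable_exp_quadratic hb _).integrableOn]
  refine integral_mono ((integrable_exp_quadratic hb _).add
    (integrable_exp_quadratic hb _)).integrableOn
    ((integrable_exp_quadratic ha s).const_mul 2).integrableOn fun z => ?_
  have h := Real.cosh_le_exp_half_sq (z * ε)
  have h1 : Real.exp (z * (s + ε) - (a + ε ^ 2 / 2) * z ^ 2) =
      Real.exp (z * s - (a + ε ^ 2 / 2) * z ^ 2) * Real.exp (z * ε) := by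
    rw [← Real.exp_add]; ring_nf
  have h2 : Real.exp (z * (s - ε) - (a + ε ^ 2 / 2) * z ^ 2) =
      Real.exp (z * s - (a + ε ^ 2 / 2) * z ^ 2) * Real.exp (-(z * ε)) := by
    rw [← Real.exp_add]; ring_nf
  have h3 : Real.exp (z * s - a * z ^ 2) =
      Real.exp (z * s - (a + ε ^ 2 / 2) * z ^ 2) * Real.exp ((z * ε) ^ 2 / 2) := by
    rw [← Real.exp_add]; ring_nf
  rw [Real.cosh_eq] at h
  change Real.exp _ + Real.exp _ ≤ 2 * Real.exp _
  rw [h1, h2, h3]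
  have := mul_le_mul_of_nonneg_left h (Real.exp_pos (z * s - (a + ε ^ 2 / 2) * z ^ 2)).le
  linarith

/-- The symmetric difference of `halfGaussian`. -/
noncomputable def halfSlope (a ε s : ℝ) : ℝ := halfGaussian a (s + ε) - halfGaussian a (s - ε)

theorem halfSlope_mono (ha : 0 < a) {ε : ℝ} (hε : 0 ≤ ε) : Monotone (halfSlope a ε) := by
  intro s t hst
  have hi (s : ℝ) := (integrable_exp_quadratic ha s).integrableOn (s := Set.Ioi (0 : ℝ))
  simp only [halfSlope, halfGaussian]
  rw [← integral_sub (hi _) (hi _), ← integral_sub (hi _) (hi _)]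
  refine setIntegral_mono_on ((hi _).sub (hi _)) ((hi _).sub (hi _)) measurableSet_Ioi
    fun z hz => ?_
  have key (s : ℝ) : Real.exp (z * (s + ε) - a * z ^ 2) - Real.exp (z * (s - ε) - a * z ^ 2) =
      Real.exp (z * s) * (Real.exp (z * ε - a * z ^ 2) - Real.exp (-(z * ε) - a * z ^ 2)) := by
    rw [mul_sub (Real.exp (z * s)), ← Real.exp_add, ← Real.exp_add]; ring_nf
  rw [key, key]
  have hz' : 0 ≤ z := le_of_lt hz
  refine mul_le_mul_of_nonneg_right (Real.exp_le_exp.2 (mul_le_mul_of_nonneg_left hst hz')) ?_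
  have := mul_nonneg hz' hε
  exact sub_nonneg.2 (Real.exp_le_exp.2 (by linarith))

theorem halfSlope_nonneg (ha : 0 < a) {ε : ℝ} (hε : 0 ≤ ε) (s : ℝ) : 0 ≤ halfSlope a ε s := by
  refine sub_nonneg.2 (setIntegral_mono_on (integrable_exp_quadratic ha _).integrableOn
    (integrable_exp_quadratic ha _).integrableOn measurableSet_Ioi fun z hz =>
      Real.exp_le_exp.2 ?_)
  have := mul_nonneg (le_of_lt hz) hε
  linarith

theorem halfSlope_sub_neg (ha : 0 < a) (ε s : ℝ) :
    halfSlope a ε s - halfSlope a ε (-s) = fullGaussian a (s + ε) - fullGaussian a (s - ε) := by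
  rw [← halfGaussian_add_neg ha, ← halfGaussian_add_neg ha]
  simp only [halfSlope]
  ring_nf

/-- The positive part of the symmetric difference of `fullGaussian` is, up to a bounded error, the
symmetric difference of `halfGaussian`. -/
theorem halfSlope_sub_max_mem (ha : 0 < a) {ε : ℝ} (hε : 0 ≤ ε) (s : ℝ) :
    halfSlope a ε s - max 0 (fullGaussian a (s + ε) - fullGaussian a (s - ε)) ∈
      Set.Icc 0 (fullGaussian a ε) := by
  have h0 : halfSlope a ε 0 ≤ fullGaussian a ε := by
    rw [halfSlope, zero_add, ← halfGaussian_add_neg ha]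
    linarith [halfGaussian_nonneg a (0 - ε), halfGaussian_nonneg a (-ε)]
  rw [← halfSlope_sub_neg ha]
  -- In both cases the error is `halfSlope` at -|s|, which monotonicity bounds by its value at 0.
  rcases le_total 0 s with hs | hs
  · have h1 := halfSlope_mono ha hε (show -s ≤ s by linarith)
    have h2 := halfSlope_mono ha hε (show -s ≤ 0 by linarith)
    rw [max_eq_right (by linarith)]
    constructor <;> linarith [halfSlope_nonneg ha hε (-s)]
  · have h1 := halfSlope_mono ha hε (show s ≤ -s by linarith)
    have h2 := halfSlope_mono ha hε hs
    rw [max_eq_left (by linarith)]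
    constructor <;> linarith [halfSlope_nonneg ha hε s]

theorem fullGaussian_anti {b : ℝ} (ha : 0 < a) (hab : a ≤ b) (s : ℝ) :
    fullGaussian b s ≤ fullGaussian a s := by
  have h1 := integrable_exp_quadratic (ha.trans_le hab) s
  rw [← integral_exp_quadratic ha, ← integral_exp_quadratic (ha.trans_le hab)]
  refine integral_mono h1 (integrable_exp_quadratic ha s) fun z => Real.exp_le_exp.2 ?_
  have := mul_le_mul_of_nonneg_right hab (sq_nonneg z)
  linarith

end halfGaussian

/-! ### One step of the matrix potential. -/

theorem sum_halfGaussian_le {a : ℝ} (ha : 0 < a) {ε : ℝ} {mu lam h : Fin d → ℝ}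
    (H : ∀ z : ℝ, 0 < z → ε * ∑ i, Real.exp (z * mu i) ≤
      ∑ i, Real.exp (z * lam i) * (ε * Real.cosh (z * ε) - h i * Real.sinh (z * ε))) :
    2 * ε * ∑ i, halfGaussian a (mu i) ≤
      ∑ i, (ε * (halfGaussian a (lam i + ε) + halfGaussian a (lam i - ε))
        - h i * halfSlope a ε (lam i)) := by
  have hi (s : ℝ) := (integrable_exp_quadratic ha s).integrableOn (s := Set.Ioi (0 : ℝ))
  have hadd (i : Fin d) : IntegrableOn (fun z : ℝ => ε * (Real.exp (z * (lam i + ε) - a * z ^ 2)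
      + Real.exp (z * (lam i - ε) - a * z ^ 2))) (Set.Ioi 0) := ((hi _).add (hi _)).const_mul _
  have hsub (i : Fin d) : IntegrableOn (fun z : ℝ => h i * (Real.exp (z * (lam i + ε) - a * z ^ 2)
      - Real.exp (z * (lam i - ε) - a * z ^ 2))) (Set.Ioi 0) := ((hi _).sub (hi _)).const_mul _
  have e1 : 2 * ε * ∑ i, halfGaussian a (mu i) =
      ∫ z in Set.Ioi (0 : ℝ), 2 * ε * ∑ i, Real.exp (z * mu i - a * z ^ 2) := by
    rw [integral_const_mul, integral_finsetSum _ fun i _ => hi _]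
    rfl
  have e2 : ∑ i, (ε * (halfGaussian a (lam i + ε) + halfGaussian a (lam i - ε))
        - h i * halfSlope a ε (lam i)) =
      ∫ z in Set.Ioi (0 : ℝ), ∑ i,
        (ε * (Real.exp (z * (lam i + ε) - a * z ^ 2) + Real.exp (z * (lam i - ε) - a * z ^ 2))
        - h i * (Real.exp (z * (lam i + ε) - a * z ^ 2)
          - Real.exp (z * (lam i - ε) - a * z ^ 2))) := by
    refine Eq.trans (Finset.sum_congr rfl fun i _ => ?_)
      (integral_finsetSum _ fun i _ => (hadd i).sub (hsub i)).symm
    refine Eq.trans ?_ (integral_sub (hadd i) (hsub i)).symm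
    rw [integral_const_mul, integral_const_mul, integral_add (hi _) (hi _),
      integral_sub (hi _) (hi _)]
    rfl
  rw [e1, e2]
  refine setIntegral_mono_on ((integrable_finsetSum _ fun i _ => hi _).const_mul _)
    (integrable_finsetSum _ fun i _ => (hadd i).sub (hsub i)) measurableSet_Ioi fun z hz => ?_
  -- The hypothesis at z is integrated against the weight 2 exp(-az²).
  have hp := (Real.exp_pos (-(a * z ^ 2))).le
  have hz' := mul_le_mul_of_nonneg_left (H z hz) (mul_nonneg zero_le_two hp)
  refine (le_of_eq ?_).trans (hz'.trans (le_of_eq ?_))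
  · simp only [sub_eq_add_neg, Real.exp_add, ← Finset.sum_mul]
    ring
  · rw [Finset.mul_sum]
    refine Finset.sum_congr rfl fun i _ => ?_
    rw [Real.cosh_eq, Real.sinh_eq]
    simp only [sub_eq_add_neg, Real.exp_add, mul_add, mul_neg]
    ring

theorem cfc_add_eq (f g : ℝ → ℝ) : cfc f A + cfc g A = cfc (fun x => f x + g x) A :=
  (cfc_add A f g (continuousOn_spectrum f) (continuousOn_spectrum g)).symm

theorem cfc_const_mul_eq (r : ℝ) (f : ℝ → ℝ) : cfc (fun x => r * f x) A = r • cfc f A :=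
  cfc_const_mul r f A (continuousOn_spectrum f)

theorem isHermitian_smul (hA : A.IsHermitian) (r : ℝ) : (r • A).IsHermitian := by
  rw [IsHermitian, conjTranspose_smul, hA.eq, star_trivial]

theorem cfc_smul_arg (hA : A.IsHermitian) (r : ℝ) (f : ℝ → ℝ) :
    cfc f (r • A) = cfc (fun x => f (r * x)) A := by
  rw [← cfc_comp_eq hA f fun x => r * x, cfc_const_mul_eq, cfc_id_eq hA]

theorem cfc_add_smul_one (hA : A.IsHermitian) (r : ℝ) (f : ℝ → ℝ) :
    cfc f (A + r • (1 : Mat d)) = cfc (fun x => f (x + r)) A := by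
  rw [← cfc_comp_eq hA f fun x => x + r, ← cfc_add_eq (fun x => x) (fun _ => r), cfc_id_eq hA,
    cfc_const_eq hA]

theorem cfc_sub_smul_one (hA : A.IsHermitian) (r : ℝ) (f : ℝ → ℝ) :
    cfc f (A - r • (1 : Mat d)) = cfc (fun x => f (x - r)) A := by
  rw [← cfc_comp_eq hA f fun x => x - r, ← cfc_sub_eq (fun x => x) (fun _ => r), cfc_id_eq hA,
    cfc_const_eq hA]

theorem abs_eigenDiag_le (hA : A.IsHermitian) {ε : ℝ} (hε : (ε • (1 : Mat d) - B).PosSemidef)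
    (hε' : (ε • (1 : Mat d) + B).PosSemidef) (i : Fin d) : |eigenDiag hA B i| ≤ ε := by
  have h1 := eigenDiag_nonneg hA hε i
  have h2 := eigenDiag_nonneg hA hε' i
  rw [eigenDiag_sub, eigenDiag_smul_one] at h1
  rw [eigenDiag_add, eigenDiag_smul_one] at h2
  exact abs_le.2 ⟨by linarith, by linarith⟩

/-- The trace of the half-Gaussian Laplace transform of a Hermitian matrix. -/
noncomputable def halfPotential (a : ℝ) (A : Mat d) : ℝ := frob 1 (cfc (halfGaussian a) A)

theorem halfPotential_eq_sum (hA : A.IsHermitian) (a : ℝ) :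
    halfPotential a A = ∑ i, halfGaussian a (hA.eigenvalues i) := by
  rw [halfPotential, frob_one_left, trace_cfc hA]

theorem halfPotential_sub_le_sum {ε a : ℝ} (hε0 : 0 < ε) (ha : 0 < a) (hA : A.IsHermitian) (hB : B.IsHermitian)
    (hε : (ε • (1 : Mat d) - B).PosSemidef) (hε' : (ε • (1 : Mat d) + B).PosSemidef) :
    2 * ε * halfPotential a (A - B) ≤
      ∑ i, (ε * (halfGaussian a (hA.eigenvalues i + ε) + halfGaussian a (hA.eigenvalues i - ε))
        - eigenDiag hA B i * halfSlope a ε (hA.eigenvalues i)) := by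
  have hAB : (A - B).IsHermitian := hA.sub hB
  rw [halfPotential_eq_sum hAB]
  refine sum_halfGaussian_le ha fun z hz => ?_
  have h := trace_exp_add_le (A := z • A) (B := -(z • B)) (mul_pos hz hε0).le
    (isHermitian_smul hA z) (isHermitian_smul hB z).neg
    (by simpa [mul_smul, smul_add] using hε'.smul hz.le)
    (by simpa [mul_smul, smul_sub, sub_eq_add_neg] using hε.smul hz.le)
  rw [← sub_eq_add_neg, ← smul_sub, cfc_smul_arg hAB, cfc_smul_arg hA, frob_neg_left,
    frob_smul_left, frob_one_left, frob_one_left, trace_cfc hAB, trace_cfc hA,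
    frob_cfc_right hA] at h
  refine le_of_mul_le_mul_left ((le_of_eq ?_).trans (h.trans (le_of_eq ?_))) hz
  · ring
  · simp only [Finset.mul_sum, ← Finset.sum_neg_distrib, ← Finset.sum_add_distrib]
    refine Finset.sum_congr rfl fun i _ => ?_
    ring

/-- Replacing the half slope by the positive part of the full difference makes the linear term
vanish by orthogonality, at a cost of at most ε · `fullGaussian a ε` per eigenvalue before division
by 2ε. -/
theorem halfPotential_sub_le {ε a : ℝ} (hε0 : 0 < ε) (ha : 0 < a) (hA : A.IsHermitian) (hB : B.IsHermitian)
    (hε : (ε • (1 : Mat d) - B).PosSemidef) (hε' : (ε • (1 : Mat d) + B).PosSemidef)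
    (horth : frob B (cfc (fun s => max 0 (fullGaussian a (s + ε) - fullGaussian a (s - ε))) A) = 0) :
    halfPotential a (A - B) ≤
      (∑ i, (halfGaussian a (hA.eigenvalues i + ε) + halfGaussian a (hA.eigenvalues i - ε))
        + d * fullGaussian a ε) / 2 := by
  have h := halfPotential_sub_le_sum hε0 ha hA hB hε hε'
  rw [frob_cfc_right hA] at horth
  have h2 : ∑ i, (ε * (halfGaussian a (hA.eigenvalues i + ε)
        + halfGaussian a (hA.eigenvalues i - ε))
        - eigenDiag hA B i * halfSlope a ε (hA.eigenvalues i)) ≤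
      ∑ i, (ε * (halfGaussian a (hA.eigenvalues i + ε) + halfGaussian a (hA.eigenvalues i - ε))
        - max 0 (fullGaussian a (hA.eigenvalues i + ε) - fullGaussian a (hA.eigenvalues i - ε))
          * eigenDiag hA B i + ε * fullGaussian a ε) := by
    refine Finset.sum_le_sum fun i _ => ?_
    have h3 := halfSlope_sub_max_mem ha hε0.le (hA.eigenvalues i)
    have h4 := (abs_le.1 (abs_eigenDiag_le hA hε hε' i)).1
    -- Since the diagonal entry is at least -ε, its negative times the replacement error is at most
    -- ε times that error.
    have h5 := mul_nonneg (show 0 ≤ ε + eigenDiag hA B i by linarith) h3.1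
    have h6 := mul_le_mul_of_nonneg_left h3.2 hε0.le
    linarith
  have h3 := h.trans h2
  rw [Finset.sum_add_distrib, Finset.sum_sub_distrib, horth, ← Finset.mul_sum] at h3
  simp only [Finset.sum_const, Finset.card_univ, Fintype.card_fin, nsmul_eq_mul] at h3
  rw [le_div_iff₀ two_pos]
  refine le_of_mul_le_mul_left ((le_of_eq ?_).trans (h3.trans (le_of_eq ?_))) hε0 <;> ring

theorem halfPotential_sub_le_add {ε a : ℝ} (hε0 : 0 < ε) (ha : 0 < a)
    (hA : A.IsHermitian) (hB : B.IsHermitian)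
    (hε : (ε • (1 : Mat d) - B).PosSemidef) (hε' : (ε • (1 : Mat d) + B).PosSemidef)
    (horth : frob B (cfc (fun s => max 0 (fullGaussian (a + ε ^ 2 / 2) (s + ε)
      - fullGaussian (a + ε ^ 2 / 2) (s - ε))) A) = 0) :
    halfPotential (a + ε ^ 2 / 2) (A - B) ≤
      halfPotential a A + d * fullGaussian (ε ^ 2 / 2) ε / 2 := by
  have h := halfPotential_sub_le hε0 (by positivity) hA hB hε hε' horth
  have h1 := Finset.sum_le_sum fun (i : Fin d) (_ : i ∈ Finset.univ) =>
    halfGaussian_average_le ha ε (hA.eigenvalues i)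
  rw [← Finset.mul_sum, ← halfPotential_eq_sum hA] at h1
  have h2 := mul_le_mul_of_nonneg_left (fullGaussian_anti (a := ε ^ 2 / 2) (by positivity)
    (show ε ^ 2 / 2 ≤ a + ε ^ 2 / 2 by linarith) ε) (Nat.cast_nonneg (α := ℝ) d)
  linarith

/-- The first round is separate: the previous parameter would be a = 0, outside the range of the
averaging step. At the zero matrix the shifted halves add up to one full Gaussian. -/
theorem halfPotential_zero_sub_le {ε : ℝ} (hε0 : 0 < ε) (hB : B.IsHermitian)
    (hε : (ε • (1 : Mat d) - B).PosSemidef) (hε' : (ε • (1 : Mat d) + B).PosSemidef)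
    (horth : frob B (cfc (fun s => max 0 (fullGaussian (ε ^ 2 / 2) (s + ε)
      - fullGaussian (ε ^ 2 / 2) (s - ε))) 0) = 0) :
    halfPotential (ε ^ 2 / 2) (0 - B) ≤ d * fullGaussian (ε ^ 2 / 2) ε := by
  have ha : 0 < ε ^ 2 / 2 := by positivity
  have h := halfPotential_sub_le hε0 ha isHermitian_zero hB hε hε' horth
  have h0 (i : Fin d) : (isHermitian_zero (n := Fin d) (α := ℂ)).eigenvalues i = 0 :=
    congrFun (isHermitian_zero.eigenvalues_eq_zero_iff.2 rfl) i
  simp only [h0, zero_add, zero_sub, halfGaussian_add_neg ha, Finset.sum_const, Finset.card_univ,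
    Fintype.card_fin, nsmul_eq_mul] at h
  rw [zero_sub]
  linarith

/-- On nonnegative eigenvalues the half transform is at least half of the full one; each negative
eigenvalue contributes only exp 0, paid for by the last term. -/
theorem sum_exp_sq_le_halfPotential {a : ℝ} (ha : 0 < a) (hA : A.IsHermitian) :
    √(Real.pi / a) * ∑ i, Real.exp ((max 0 (hA.eigenvalues i)) ^ 2 / (4 * a)) ≤
      2 * halfPotential a A + d * √(Real.pi / a) := by
  rw [halfPotential_eq_sum hA, Finset.mul_sum, Finset.mul_sum]
  have : (d : ℝ) * √(Real.pi / a) = ∑ _i : Fin d, √(Real.pi / a) := by simp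
  rw [this, ← Finset.sum_add_distrib]
  refine Finset.sum_le_sum fun i _ => ?_
  rcases le_total 0 (hA.eigenvalues i) with h | h
  · rw [max_eq_right h]
    have := fullGaussian_le_two_mul_halfGaussian ha h
    rw [fullGaussian] at this
    linarith [Real.sqrt_nonneg (Real.pi / a)]
  · rw [max_eq_left h]
    have := halfGaussian_nonneg a (hA.eigenvalues i)
    simp
    linarith

/-! ### The Gibbs variational inequality. -/

/-- This is log y ≤ y - 1 at y = exp a / (M x). In the Gibbs inequality the last two terms sum to at
most 0. -/
theorem log_inner_bound {x a M : ℝ} (hx : 0 ≤ x) (hM : 0 < M) :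
    x * (a - Real.log M) ≤ x * Real.log x - x + Real.exp a / M := by
  rcases hx.eq_or_lt with rfl | hx
  · simp; positivity
  have h := Real.log_le_sub_one_of_pos (show 0 < Real.exp a / M / x by positivity)
  rw [Real.log_div (by positivity) hx.ne', Real.log_div (by positivity) hM.ne', Real.log_exp] at h
  have h2 := mul_le_mul_of_nonneg_left h hx.le
  have h3 : x * (Real.exp a / M / x - 1) = Real.exp a / M - x := by field_simp
  rw [h3] at h2
  linarith

/-- The Gibbs variational inequality. -/
theorem frob_cfc_le_entropy_add_log {X : Mat d} (hX : X ∈ spectraplex d) (hA : A.IsHermitian)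
    (f : ℝ → ℝ) {M : ℝ} (hM : 0 < M) (hf : ∑ i, Real.exp (f (hA.eigenvalues i)) ≤ M) :
    frob X (cfc f A) ≤ frob X (cfc Real.log X) + Real.log M := by
  have hXh := hX.1.1
  have htr : ∑ i, hXh.eigenvalues i = 1 := by
    rw [← trace_cfc hXh fun x => x, cfc_id_eq hXh, hX.2]; simp
  have h1 := frob_cfc_cfc hXh hA (fun x => x) f
  rw [cfc_id_eq hXh] at h1
  have h2 : frob X (cfc Real.log X) = ∑ i, hXh.eigenvalues i * Real.log (hXh.eigenvalues i) := by
    have := cfc_mul_eq (A := X) (fun x => x) Real.log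
    rw [cfc_id_eq hXh] at this
    rw [frob, this, trace_cfc hXh]
  have key : ∑ i, ∑ j, overlap hXh hA i j *
        (hXh.eigenvalues i * (f (hA.eigenvalues j) - Real.log M)) ≤
      ∑ i, ∑ j, overlap hXh hA i j * (hXh.eigenvalues i * Real.log (hXh.eigenvalues i)
        - hXh.eigenvalues i + Real.exp (f (hA.eigenvalues j)) / M) :=
    Finset.sum_le_sum fun i _ => Finset.sum_le_sum fun j _ =>
      mul_le_mul_of_nonneg_left (log_inner_bound (hX.1.eigenvalues_nonneg i) hM)
        (overlap_nonneg ..)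
  have e1 := sum_overlap_left hXh hA fun x => x * Real.log M
  have e2 := sum_overlap_left hXh hA fun x => x * Real.log x - x
  have e3 := sum_overlap_right hXh hA fun x => Real.exp (f x) / M
  simp only [mul_sub, mul_add, Finset.sum_sub_distrib, Finset.sum_add_distrib] at key e2
  simp only [e1, e3] at key
  rw [← Finset.sum_mul, htr, ← h1] at key
  rw [← Finset.sum_div] at key
  have hM' := (div_le_one hM).2 hf
  rw [htr, ← h2] at e2
  linarith

/-! ### Semidefinite order bounds and the surrogate loss. -/

theorem frob_mem_spectraplex_mono {X : Mat d} (hX : X ∈ spectraplex d)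
    (h : (B - A).PosSemidef) : frob A X ≤ frob B X := by
  have := frob_nonneg h hX.1
  rw [frob_sub_left] at this
  linarith

theorem posSemidef_of_opNorm_le (hA : A.IsHermitian) {l : ℝ} (h : opNorm A ≤ l) :
    (l • (1 : Mat d) - A).PosSemidef ∧ (l • (1 : Mat d) + A).PosSemidef := by
  have hb (i : Fin d) : |hA.eigenvalues i| ≤ l := by
    have h1 := (toEuclideanCLM (n := Fin d) (𝕜 := ℂ) A).le_opNorm (hA.eigenvectorBasis i)
    have h2 : toEuclideanCLM (n := Fin d) (𝕜 := ℂ) A (hA.eigenvectorBasis i) =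
        (hA.eigenvalues i : ℂ) • hA.eigenvectorBasis i := by
      ext j
      have := congrFun (hA.mulVec_eigenvectorBasis i) j
      simpa [ofLp_toEuclideanCLM] using this
    rw [h2, norm_smul, hA.eigenvectorBasis.norm_eq_one, mul_one, mul_one, Complex.norm_real] at h1
    exact h1.trans h
  constructor
  · have := posSemidef_cfc hA (f := fun x => l - x) fun i => by linarith [(abs_le.1 (hb i)).2]
    rwa [← cfc_sub_eq, cfc_const_eq hA, cfc_id_eq hA] at this
  · have := posSemidef_cfc hA (f := fun x => l + x) fun i => by linarith [(abs_le.1 (hb i)).1]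
    rwa [← cfc_add_eq, cfc_const_eq hA, cfc_id_eq hA] at this

theorem posSemidef_one_sub (hA : A.PosSemidef) (h : A.trace.re ≤ 1) :
    ((1 : Mat d) - A).PosSemidef := by
  have := posSemidef_cfc hA.1 (f := fun x => 1 - x) fun i => by
    rw [← cfc_id_eq hA.1, trace_cfc hA.1] at h
    have := Finset.single_le_sum (f := hA.1.eigenvalues) (fun j _ => hA.eigenvalues_nonneg j)
      (Finset.mem_univ i)
    linarith
  rwa [← cfc_sub_eq, cfc_one_eq hA.1, cfc_id_eq hA.1] at this

theorem frob_le_trace {l : ℝ} (h : (l • (1 : Mat d) - A).PosSemidef) (hB : B.PosSemidef) :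
    frob A B ≤ l * B.trace.re := by
  have := frob_nonneg h hB
  rw [frob_sub_left, frob_smul_left, frob_one_left] at this
  linarith

theorem neg_le_frob_trace {l : ℝ} (h : (l • (1 : Mat d) + A).PosSemidef) (hB : B.PosSemidef) :
    -(l * B.trace.re) ≤ frob A B := by
  have := frob_nonneg h hB
  rw [frob_add_left, frob_smul_left, frob_one_left] at this
  linarith

theorem posSemidef_posSpec (hA : A.IsHermitian) : (posSpec A).PosSemidef :=
  posSemidef_cfc hA fun _ => le_max_left _ _

theorem posSemidef_neg_negDirection (hA : A.IsHermitian) : (-negDirection A).PosSemidef := by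
  have h : (cfc (fun x : ℝ => -1 * min 0 x) A).PosSemidef := posSemidef_cfc hA fun i => by
    have := min_le_left 0 (hA.eigenvalues i)
    linarith
  rw [cfc_const_mul_eq, neg_one_smul] at h
  rw [negDirection, ← smul_neg]
  exact h.smul (inv_nonneg.2 (abs_nonneg _))

/-- Only an inequality: if the negative part vanishes, the inverse is 0 and so is the direction. -/
theorem trace_neg_negDirection_le : (-negDirection A).trace.re ≤ 1 := by
  rw [negDirection, trace_neg, trace_smul, Complex.neg_re, Complex.smul_re, smul_eq_mul]
  change -(|reTrace (negSpec A)|⁻¹ * reTrace (negSpec A)) ≤ 1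
  rw [← mul_neg]
  refine (mul_le_mul_of_nonneg_left (neg_le_abs _) (inv_nonneg.2 (abs_nonneg _))).trans ?_
  exact inv_mul_le_one

theorem normalizedPos_mem_spectraplex {F : Mat d} (hF : F ∈ spectraplex d) (hA : A.IsHermitian) :
    normalizedPos F A ∈ spectraplex d := by
  rw [normalizedPos]
  split_ifs with h
  · exact hF
  have hp := posSemidef_posSpec hA
  refine ⟨hp.smul (inv_nonneg.2 (Complex.le_def.1 hp.trace_nonneg).1), ?_⟩
  have hre : (posSpec A).trace = (reTrace (posSpec A) : ℂ) :=
    Complex.ext rfl (by simpa using (Complex.le_def.1 hp.trace_nonneg).2.symm)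
  rw [trace_smul, hre, Complex.real_smul, ← Complex.ofReal_mul, inv_mul_cancel₀ h,
    Complex.ofReal_one]

/-- This survives the fallback case, since a positive semidefinite matrix of trace zero is zero. -/
theorem posSpec_eq_smul_normalizedPos (F : Mat d) (hA : A.IsHermitian) :
    posSpec A = reTrace (posSpec A) • normalizedPos F A := by
  rw [normalizedPos]
  split_ifs with h
  · have hp := posSemidef_posSpec hA
    rw [h, zero_smul, ← hp.trace_eq_zero_iff]
    exact Complex.ext h (by simpa using (Complex.le_def.1 hp.trace_nonneg).2.symm)
  · rw [smul_smul, mul_inv_cancel₀ h, one_smul]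

theorem frob_negDirection_posSpec (hA : A.IsHermitian) : frob (negDirection A) (posSpec A) = 0 := by
  have h : negSpec A * posSpec A = cfc (fun x : ℝ => min 0 x * max 0 x) A := cfc_mul_eq _ _
  rw [negDirection, frob_smul_left, frob, h, trace_cfc hA]
  have h0 (x : ℝ) : min 0 x * max 0 x = 0 := by
    rw [min_mul_max, zero_mul]
  simp [h0]

theorem frob_centeredLoss_self {X G : Mat d} (hX : X ∈ spectraplex d) :
    frob (centeredLoss X G) X = 0 := by
  rw [centeredLoss, frob_sub_left, frob_smul_left, frob_one_left, hX.2]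
  simp

/-- A common form for both branches of the surrogate, with the sign of the direction flipped to make
it positive semidefinite for Hermitian `Xt`. -/
theorem surrogateLoss_eq_centeredLoss_sub (Xt X G : Mat d) :
    ∃ m : ℝ, 0 ≤ m ∧ m ≤ max 0 (frob (centeredLoss X G) (-negDirection Xt)) ∧
      surrogateLoss Xt X G = centeredLoss X G - m • (-negDirection Xt) := by
  rw [surrogateLoss]
  split_ifs with h
  · exact ⟨0, le_rfl, le_max_left _ _, by simp⟩
  · refine ⟨_, le_max_left _ _, le_rfl, ?_⟩
    have h1 (y : ℝ) : max 0 (-y) = - min 0 y := by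
      rw [← neg_zero, max_neg_neg, neg_zero]
    have h2 : frob (centeredLoss X G) (-negDirection Xt) =
        -frob (centeredLoss X G) (negDirection Xt) := by simp [frob]
    rw [h2, h1, neg_smul_neg]

/-- The centered loss is orthogonal to the prediction, a normalization of the positive part, and the
correction is supported on the negative eigenspaces. -/
theorem frob_surrogateLoss_posSpec {F Xt : Mat d} (G : Mat d) (hF : F ∈ spectraplex d)
    (hXt : Xt.IsHermitian) :
    frob (surrogateLoss Xt (normalizedPos F Xt) G) (posSpec Xt) = 0 := by
  obtain ⟨m, -, -, hm⟩ := surrogateLoss_eq_centeredLoss_sub Xt (normalizedPos F Xt) G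
  rw [hm, frob_sub_left, frob_smul_left, frob_neg_left, frob_negDirection_posSpec hXt,
    posSpec_eq_smul_normalizedPos F hXt, frob_smul_right,
    frob_centeredLoss_self (normalizedPos_mem_spectraplex hF hXt)]
  simp

theorem surrogateLoss_bounds {Xt X G : Mat d} {l : ℝ} (hXt : Xt.IsHermitian)
    (hX : X ∈ spectraplex d) (hG : G.IsHermitian) (hGl : opNorm G ≤ l) :
    (surrogateLoss Xt X G).IsHermitian ∧
    ((2 * l) • (1 : Mat d) - surrogateLoss Xt X G).PosSemidef ∧
    ((2 * l) • (1 : Mat d) + surrogateLoss Xt X G).PosSemidef ∧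
    (centeredLoss X G - surrogateLoss Xt X G).PosSemidef := by
  obtain ⟨m, hm0, hm1, hm⟩ := surrogateLoss_eq_centeredLoss_sub Xt X G
  obtain ⟨h1, h2⟩ := posSemidef_of_opNorm_le hG hGl
  have hP := posSemidef_neg_negDirection hXt
  have hPt := trace_neg_negDirection_le (A := Xt)
  have hPt0 : 0 ≤ (-negDirection Xt).trace.re := (Complex.le_def.1 hP.trace_nonneg).1
  set P := -negDirection Xt
  have hx1 : frob G X ≤ l := by simpa [hX.2] using frob_le_trace h1 hX.1
  have hx2 : -l ≤ frob G X := by simpa [hX.2] using neg_le_frob_trace h2 hX.1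
  -- This keeps the correction small enough for the surrogate to stay within ±2l, which is why ε =
  -- 2l.
  have hml : m ≤ l - frob G X := by
    refine hm1.trans (max_le (by linarith) ?_)
    rw [centeredLoss, frob_sub_left, frob_smul_left, frob_one_left]
    have := frob_le_trace h1 hP
    nlinarith
  have one : (1 : Mat d).PosSemidef := PosSemidef.one
  have e1 : (2 * l) • (1 : Mat d) - surrogateLoss Xt X G =
      (l • (1 : Mat d) - G) + (l + frob G X) • (1 : Mat d) + m • P := by
    rw [hm, centeredLoss]; module
  have e2 : (2 * l) • (1 : Mat d) + surrogateLoss Xt X G =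
      (l • (1 : Mat d) + G) + (l - frob G X - m) • (1 : Mat d) + m • (1 - P) := by
    rw [hm, centeredLoss]; module
  have e3 : centeredLoss X G - surrogateLoss Xt X G = m • P := by
    rw [hm]; abel
  refine ⟨?_, ?_, ?_, ?_⟩
  · rw [hm, centeredLoss]
    exact (hG.sub (isHermitian_smul isHermitian_one _)).sub (isHermitian_smul hP.1 _)
  · rw [e1]
    exact (h1.add (one.smul (by linarith))).add (hP.smul hm0)
  · rw [e2]
    exact (h2.add (one.smul (by linarith))).add ((posSemidef_one_sub hP hPt).smul hm0)
  · rw [e3]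
    exact hP.smul hm0

/-! ### The algorithm in terms of Gaussian transforms, and the comparator's entropy. -/

theorem expSq_eq_fullGaussian (hd : 0 < d) {l : ℝ} (hl : 0 < l) {t : ℕ} (ht : 0 < t) :
    ∃ c : ℝ, 0 < c ∧ ∀ s, expSq d l t s = c * fullGaussian (t * ((2 * l) ^ 2 / 2)) s := by
  have ht' : (0 : ℝ) < t := Nat.cast_pos.2 ht
  have hd' : (0 : ℝ) < d := Nat.cast_pos.2 hd
  have hq : 0 < √(Real.pi / (t * ((2 * l) ^ 2 / 2))) := Real.sqrt_pos.2 (by positivity)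
  refine ⟨(2 * l) / (d * √(t : ℝ)) / √(Real.pi / (t * ((2 * l) ^ 2 / 2))), by positivity,
    fun s => ?_⟩
  rw [expSq, fullGaussian, ← mul_assoc, div_mul_cancel₀ _ hq.ne']
  congr 3
  ring

theorem unconstrained_predict_eq (hd : 0 < d) {l : ℝ} (hl : 0 < l) {t : ℕ} (ht : 0 < t)
    {S : Mat d} (hS : S.IsHermitian) :
    ∃ c : ℝ, 0 < c ∧ (unconstrained d l (expSq d l)).predict t S =
      cfc (fun s => c * (fullGaussian (t * ((2 * l) ^ 2 / 2)) (s + 2 * l)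
        - fullGaussian (t * ((2 * l) ^ 2 / 2)) (s - 2 * l))) S := by
  obtain ⟨c, hc, h⟩ := expSq_eq_fullGaussian hd hl ht
  refine ⟨1 / (2 * (2 * l)) * c, by positivity, ?_⟩
  change (1 / (2 * (2 * l))) • (cfc (expSq d l t) (S + (2 * l) • (1 : Mat d))
    - cfc (expSq d l t) (S - (2 * l) • (1 : Mat d))) = _
  rw [cfc_add_smul_one hS, cfc_sub_smul_one hS, cfc_sub_eq, ← cfc_const_mul_eq]
  refine congrArg (fun f => cfc f S) (funext fun s => ?_)
  rw [h, h]
  ring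

theorem posSpec_cfc_const_mul (hA : A.IsHermitian) {c : ℝ} (hc : 0 ≤ c) (f : ℝ → ℝ) :
    posSpec (cfc (fun s => c * f s) A) = c • cfc (fun s => max 0 (f s)) A := by
  change cfc (fun x => max 0 x) _ = _
  rw [cfc_comp_eq hA, ← cfc_const_mul_eq]
  refine congrArg (fun f => cfc f A) (funext fun s => ?_)
  rw [mul_max_of_nonneg _ _ hc, mul_zero]

theorem relEntropy_smul_one {X : Mat d} (hX : X ∈ spectraplex d) :
    relEntropy X ((d : ℝ)⁻¹ • (1 : Mat d)) = frob X (cfc Real.log X) + Real.log d := by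
  have h : cfc Real.log ((d : ℝ)⁻¹ • (1 : Mat d)) = Real.log (d : ℝ)⁻¹ • (1 : Mat d) := by
    rw [← cfc_const_eq (A := 1) isHermitian_one, cfc_comp_eq isHermitian_one,
      cfc_const_eq isHermitian_one]
  change frob X (cfc Real.log X - cfc Real.log _) = _
  rw [h, frob_sub_right, frob_smul_right, frob_one_right, hX.2, Real.log_inv]
  simp

/-- Cauchy–Schwarz in the state `X`, combined with the Gibbs inequality. -/
theorem frob_le_sqrt_entropy {X : Mat d} (hX : X ∈ spectraplex d) (hA : A.IsHermitian)
    {b M : ℝ} (hb : 0 < b) (hM : 0 < M)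
    (h : ∑ i, Real.exp ((max 0 (hA.eigenvalues i)) ^ 2 / b) ≤ M) :
    frob A X ≤ √(b * (frob X (cfc Real.log X) + Real.log M)) := by
  have hg := frob_cfc_le_entropy_add_log hX hA (fun x => (max 0 x) ^ 2 / b) hM h
  rw [frob_cfc_right hA] at hg
  have hA' : frob A X = ∑ i, hA.eigenvalues i * eigenDiag hA X i := by
    rw [frob_comm, ← frob_cfc_right hA X fun x => x, cfc_id_eq hA]
  have h1 : ∑ i, eigenDiag hA X i = 1 := by
    have := frob_cfc_right hA X fun _ => 1
    rw [cfc_one_eq hA, frob_one_right, hX.2] at this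
    simpa using this.symm
  have hq (i : Fin d) : 0 ≤ eigenDiag hA X i := eigenDiag_nonneg hA hX.1 i
  set q := eigenDiag hA X
  set u : Fin d → ℝ := fun i => max 0 (hA.eigenvalues i) with hu
  set m := ∑ i, u i * q i with hm
  have hle : frob A X ≤ m := by
    rw [hA']
    exact Finset.sum_le_sum fun i _ => mul_le_mul_of_nonneg_right (le_max_right _ _) (hq i)
  -- Nonnegativity of the variance of u under the probability weights q.
  have hsq : m ^ 2 ≤ ∑ i, u i ^ 2 * q i := by
    have h0 : 0 ≤ ∑ i, (u i - m) ^ 2 * q i :=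
      Finset.sum_nonneg fun i _ => mul_nonneg (sq_nonneg _) (hq i)
    have h2 : ∑ i, (u i - m) ^ 2 * q i = ∑ i, u i ^ 2 * q i - 2 * m * m + m ^ 2 * ∑ i, q i := by
      conv_rhs => rw [hm]
      rw [← hm, mul_assoc, hm, Finset.mul_sum, Finset.mul_sum, Finset.mul_sum, ← hm,
        ← Finset.sum_sub_distrib, ← Finset.sum_add_distrib]
      exact Finset.sum_congr rfl fun i _ => by ring
    rw [h2, h1] at h0
    linarith
  refine hle.trans (Real.le_sqrt_of_sq_le (hsq.trans ?_))
  have h3 : ∑ i, u i ^ 2 * q i = b * ∑ i, u i ^ 2 / b * q i := by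
    rw [Finset.mul_sum]
    exact Finset.sum_congr rfl fun i _ => by field_simp
  rw [h3]
  exact mul_le_mul_of_nonneg_left hg hb.le

/-! ### Growth of the potential along the run, and the regret. -/

section analysis

variable {l : ℝ} {F G : ℕ → Mat d}

/-- The matrix `S` maintained by the algorithm. -/
noncomputable def stateMatrix (l : ℝ) (F G : ℕ → Mat d) (n : ℕ) : Mat d :=
  (reduction (unconstrained d l (expSq d l)) F).stateAfter G n

/-- The base prediction of round `n + 1`. -/
noncomputable def basePrediction (l : ℝ) (F G : ℕ → Mat d) (n : ℕ) : Mat d :=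
  (unconstrained d l (expSq d l)).predict (n + 1) (stateMatrix l F G n)

/-- The surrogate loss of round `n + 1`. -/
noncomputable def surrogate (l : ℝ) (F G : ℕ → Mat d) (n : ℕ) : Mat d :=
  surrogateLoss (basePrediction l F G n) (normalizedPos (F (n + 1)) (basePrediction l F G n)) (G n)

theorem prediction_eq (n : ℕ) :
    (reduction (unconstrained d l (expSq d l)) F).prediction G n =
      normalizedPos (F (n + 1)) (basePrediction l F G n) := rfl

theorem stateMatrix_zero : stateMatrix l F G 0 = 0 := rfl

theorem stateMatrix_succ (n : ℕ) :
    stateMatrix l F G (n + 1) = stateMatrix l F G n - surrogate l F G n := rfl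

theorem isHermitian_basePrediction (hd : 0 < d) (hl : 0 < l) {n : ℕ}
    (hS : (stateMatrix l F G n).IsHermitian) : (basePrediction l F G n).IsHermitian := by
  obtain ⟨c, -, h⟩ := unconstrained_predict_eq hd hl n.succ_pos hS
  rw [show basePrediction l F G n = _ from h]
  exact isHermitian_cfc _

theorem surrogate_bounds (hd : 0 < d) (hl : 0 < l) (hF : ∀ t, F t ∈ spectraplex d)
    (hG : ∀ n, (G n).IsHermitian) (hGl : ∀ n, opNorm (G n) ≤ l) {n : ℕ}
    (hS : (stateMatrix l F G n).IsHermitian) :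
    (surrogate l F G n).IsHermitian ∧
    ((2 * l) • (1 : Mat d) - surrogate l F G n).PosSemidef ∧
    ((2 * l) • (1 : Mat d) + surrogate l F G n).PosSemidef ∧
    (centeredLoss (normalizedPos (F (n + 1)) (basePrediction l F G n)) (G n)
      - surrogate l F G n).PosSemidef :=
  have hb := isHermitian_basePrediction hd hl hS
  surrogateLoss_bounds hb (normalizedPos_mem_spectraplex (hF (n + 1)) hb) (hG n) (hGl n)

theorem isHermitian_stateMatrix (hd : 0 < d) (hl : 0 < l) (hF : ∀ t, F t ∈ spectraplex d)
    (hG : ∀ n, (G n).IsHermitian) (hGl : ∀ n, opNorm (G n) ≤ l) (n : ℕ) :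
    (stateMatrix l F G n).IsHermitian := by
  induction n with
  | zero => exact isHermitian_zero
  | succ n ih => exact ih.sub (surrogate_bounds hd hl hF hG hGl ih).1

theorem frob_surrogate_eq_zero (hd : 0 < d) (hl : 0 < l) (hF : ∀ t, F t ∈ spectraplex d) {n : ℕ}
    (hS : (stateMatrix l F G n).IsHermitian) :
    frob (surrogate l F G n) (cfc (fun s => max 0
      (fullGaussian ((n + 1 : ℕ) * ((2 * l) ^ 2 / 2)) (s + 2 * l)
        - fullGaussian ((n + 1 : ℕ) * ((2 * l) ^ 2 / 2)) (s - 2 * l))) (stateMatrix l F G n)) =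
      0 := by
  obtain ⟨c, hc, h⟩ := unconstrained_predict_eq hd hl n.succ_pos hS
  have h0 := frob_surrogateLoss_posSpec (G n) (hF (n + 1)) (isHermitian_basePrediction hd hl hS)
  change frob (surrogate l F G n) (posSpec (basePrediction l F G n)) = 0 at h0
  rw [show basePrediction l F G n = _ from h, posSpec_cfc_const_mul hS hc.le,
    frob_smul_right] at h0
  exact (mul_eq_zero.1 h0).resolve_left hc.ne'

/-- The first round contributes one unit d · `fullGaussian`, every later round half a unit. -/
theorem halfPotential_stateMatrix_le (hd : 0 < d) (hl : 0 < l) (hF : ∀ t, F t ∈ spectraplex d)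
    (hG : ∀ n, (G n).IsHermitian) (hGl : ∀ n, opNorm (G n) ≤ l) (n : ℕ) :
    halfPotential ((n + 1 : ℕ) * ((2 * l) ^ 2 / 2)) (stateMatrix l F G (n + 1)) ≤
      (n + 2) / 2 * (d * fullGaussian ((2 * l) ^ 2 / 2) (2 * l)) := by
  have hS := isHermitian_stateMatrix hd hl hF hG hGl
  have hs (n : ℕ) := surrogate_bounds hd hl hF hG hGl (hS n)
  have hε : 0 < 2 * l := by positivity
  induction n with
  | zero =>
    have h0 := frob_surrogate_eq_zero (G := G) hd hl hF (hS 0)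
    simp only [zero_add, Nat.cast_one, one_mul] at h0 ⊢
    have := halfPotential_zero_sub_le hε (hs 0).1 (hs 0).2.1 (hs 0).2.2.1 h0
    refine this.trans (le_of_eq ?_)
    simp
  | succ n ih =>
    have h0 := frob_surrogate_eq_zero (G := G) hd hl hF (hS (n + 1))
    have e : ((n + 1 + 1 : ℕ) : ℝ) * ((2 * l) ^ 2 / 2) =
        (n + 1 : ℕ) * ((2 * l) ^ 2 / 2) + (2 * l) ^ 2 / 2 := by push_cast; ring
    rw [e] at h0 ⊢
    have := halfPotential_sub_le_add hε (by positivity) (hS (n + 1)) (hs (n + 1)).1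
      (hs (n + 1)).2.1 (hs (n + 1)).2.2.1 h0
    refine (this.trans (add_le_add_left ih _)).trans (le_of_eq ?_)
    push_cast
    ring

/-- Each regret increment is -⟨centered loss, X⟩, and the surrogate lies below the centered loss in
the semidefinite order. -/
theorem regret_le_frob_stateMatrix (hd : 0 < d) (hl : 0 < l) (hF : ∀ t, F t ∈ spectraplex d)
    (hG : ∀ n, (G n).IsHermitian) (hGl : ∀ n, opNorm (G n) ≤ l) {X : Mat d}
    (hX : X ∈ spectraplex d) (n : ℕ) :
    (reduction (unconstrained d l (expSq d l)) F).regret G n X ≤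
      frob (stateMatrix l F G n) X := by
  induction n with
  | zero => simp [OnlineAlgorithm.regret, stateMatrix_zero, frob]
  | succ n ih =>
    have h := frob_mem_spectraplex_mono hX
      (surrogate_bounds hd hl hF hG hGl (isHermitian_stateMatrix hd hl hF hG hGl n)).2.2.2
    rw [centeredLoss, frob_sub_left, frob_smul_left, frob_one_left, hX.2, Complex.one_re,
      mul_one] at h
    rw [OnlineAlgorithm.regret] at ih ⊢
    rw [Finset.sum_range_succ, Finset.sum_range_succ, stateMatrix_succ, frob_sub_left,
      prediction_eq]
    linarith

theorem fullGaussian_step_eq {ε : ℝ} (hε : 0 < ε) {T : ℝ} (hT : 0 < T) :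
    fullGaussian (ε ^ 2 / 2) ε =
      √(Real.pi / (T * (ε ^ 2 / 2))) * (√T * Real.exp (1 / 2)) := by
  rw [fullGaussian, ← mul_assoc, ← Real.sqrt_mul (by positivity)]
  congr 2 <;> field_simp
  norm_num

/-- The exponent 4 becomes the 4 log T of the final bound. The inequality fails at T = 1. -/
theorem sqrt_growth_le {T : ℝ} (hT : 2 ≤ T) : (T + 1) * (√T * Real.exp (1 / 2)) + 1 ≤ T ^ 4 := by
  have h1 : Real.exp (1 / 2) ≤ 2 := by
    have h := Real.exp_one_lt_d9
    have h2 : Real.exp (1 / 2) ^ 2 = Real.exp 1 := by rw [← Real.exp_nat_mul]; norm_num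
    nlinarith [Real.exp_pos (1 / 2 : ℝ)]
  have h2 : √T ≤ 3 / 4 * T := Real.sqrt_le_iff.2 ⟨by linarith, by nlinarith⟩
  have h3 : √T * Real.exp (1 / 2) ≤ 3 / 4 * T * 2 :=
    mul_le_mul h2 h1 (Real.exp_pos _).le (by linarith)
  have h4 := mul_le_mul_of_nonneg_left h3 (show 0 ≤ T + 1 by linarith)
  have h5 : 4 * T ^ 2 ≤ T ^ 4 := by
    nlinarith [mul_nonneg (sq_nonneg T) (show 0 ≤ T ^ 2 - 4 by nlinarith)]
  nlinarith

theorem sum_exp_stateMatrix_le (hd : 0 < d) (hl : 0 < l) (hF : ∀ t, F t ∈ spectraplex d)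
    (hG : ∀ n, (G n).IsHermitian) (hGl : ∀ n, opNorm (G n) ≤ l) {T : ℕ} (hT : 2 ≤ T)
    (hS : (stateMatrix l F G T).IsHermitian) :
    ∑ i, Real.exp ((max 0 (hS.eigenvalues i)) ^ 2 / (4 * (T * ((2 * l) ^ 2 / 2)))) ≤
      d * (T : ℝ) ^ 4 := by
  have hT2 : (2 : ℝ) ≤ T := by exact_mod_cast hT
  have hT0 : (0 : ℝ) < T := by linarith
  have hp : halfPotential (T * ((2 * l) ^ 2 / 2)) (stateMatrix l F G T) ≤
      (T + 1) / 2 * (d * fullGaussian ((2 * l) ^ 2 / 2) (2 * l)) := by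
    obtain ⟨n, rfl⟩ : ∃ n, T = n + 1 := ⟨T - 1, by omega⟩
    refine (halfPotential_stateMatrix_le hd hl hF hG hGl n).trans (le_of_eq ?_)
    push_cast
    ring
  have ha : 0 < T * ((2 * l) ^ 2 / 2) := by positivity
  have h := sum_exp_sq_le_halfPotential ha hS
  rw [fullGaussian_step_eq (ε := 2 * l) (by positivity) hT0] at hp
  have hq : 0 < √(Real.pi / (T * ((2 * l) ^ 2 / 2))) := Real.sqrt_pos.2 (by positivity)
  refine le_of_mul_le_mul_left (h.trans ?_) hq
  have h2 := mul_le_mul_of_nonneg_left (sqrt_growth_le hT2) (mul_pos hq (Nat.cast_pos.2 hd)).le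
  linarith

end analysis

end MatrixLEA

/-! ### The regret bound. -/

open MatrixLEA in
theorem theorem4p1 (d : ℕ) (l : ℝ) (hl : 0 < l)
    (F : ℕ → MatrixLEA.Mat d) (hF : ∀ t, F t ∈ MatrixLEA.spectraplex d)
    (G : ℕ → MatrixLEA.Mat d) (hG : ∀ n, (G n).IsHermitian)
    (hGl : ∀ n, MatrixLEA.opNorm (G n) ≤ l) :
    (∀ n, (MatrixLEA.reduction (MatrixLEA.unconstrained d l (MatrixLEA.expSq d l)) F).prediction G n
        ∈ MatrixLEA.spectraplex d) ∧
    ∀ T : ℕ, 1 ≤ T → ∀ X ∈ MatrixLEA.spectraplex d,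
      (MatrixLEA.reduction (MatrixLEA.unconstrained d l (MatrixLEA.expSq d l)) F).regret G T X ≤
        2 * √2 * l * √(T * MatrixLEA.relEntropy X ((d : ℝ)⁻¹ • (1 : MatrixLEA.Mat d)))
          + 4 * √2 * l * √(T * Real.log T) + 2 * √(Real.exp 1) * l := by
  -- For d = 0 the trace is 0, so the spectraplex is empty and no fallback could exist.
  have hd : 0 < d := by
    rcases Nat.eq_zero_or_pos d with rfl | h
    · have := (hF 0).2
      simp [Matrix.trace] at this
    · exact h
  have hmem (n : ℕ) : (reduction (unconstrained d l (expSq d l)) F).prediction G n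
      ∈ spectraplex d :=
    normalizedPos_mem_spectraplex (hF _)
      (isHermitian_basePrediction hd hl (isHermitian_stateMatrix hd hl hF hG hGl n))
  refine ⟨hmem, fun T hT X hX => ?_⟩
  rw [relEntropy_smul_one hX]
  set E := frob X (cfc Real.log X) + Real.log d with hE
  have hlast : 0 ≤ 2 * √(Real.exp 1) * l := by positivity
  -- For T = 1 the trivial bound 2l suffices; only here is the additive constant needed.
  rcases hT.eq_or_lt with rfl | hT
  · obtain ⟨h1, h2⟩ := posSemidef_of_opNorm_le (hG 0) (hGl 0)
    have h3 := frob_le_trace h1 (hmem 0).1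
    have h4 := neg_le_frob_trace h2 hX.1
    rw [(hmem 0).2, Complex.one_re, mul_one] at h3
    rw [hX.2, Complex.one_re, mul_one] at h4
    have h5 : 1 ≤ √(Real.exp 1) := Real.one_le_sqrt.2 (Real.one_le_exp zero_le_one)
    have h6 := mul_le_mul_of_nonneg_right h5 hl.le
    have h7 : 0 ≤ 2 * √2 * l * √((1 : ℕ) * E) + 4 * √2 * l * √((1 : ℕ) * Real.log (1 : ℕ)) := by
      positivity
    rw [OnlineAlgorithm.regret, Finset.sum_range_one, Finset.sum_range_one]
    linarith
  have hS := isHermitian_stateMatrix hd hl hF hG hGl T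
  have hT0 : (0 : ℝ) < T := by exact_mod_cast hT.trans' zero_lt_one
  have hd0 : (0 : ℝ) < d := Nat.cast_pos.2 hd
  have hlog : 0 ≤ Real.log T := Real.log_nonneg (by exact_mod_cast hT.le)
  -- Nonnegativity of the relative entropy is the Gibbs inequality for f = 0 and M = d.
  have hE0 : 0 ≤ E := by
    have := frob_cfc_le_entropy_add_log hX hS (fun _ => 0) hd0 (by simp)
    rwa [cfc_const_eq hS, zero_smul, show frob X 0 = 0 by simp [frob]] at this
  have hmain := (regret_le_frob_stateMatrix hd hl hF hG hGl hX T).trans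
    (frob_le_sqrt_entropy hX hS (by positivity) (by positivity)
      (sum_exp_stateMatrix_le hd hl hF hG hGl hT hS))
  refine hmain.trans ?_
  have e : 4 * (T * ((2 * l) ^ 2 / 2)) * (frob X (cfc Real.log X) + Real.log (d * (T : ℝ) ^ 4)) =
      (2 * l) ^ 2 * (2 * (T * E + 4 * (T * Real.log T))) := by
    rw [Real.log_mul hd0.ne' (by positivity), Real.log_pow, hE]
    push_cast
    ring
  have hsplit : √(T * E + 4 * (T * Real.log T)) ≤ √(T * E) + 2 * √(T * Real.log T) := by
    have h1 := Real.sq_sqrt (show 0 ≤ T * E by positivity)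
    have h2 := Real.sq_sqrt (show 0 ≤ T * Real.log T by positivity)
    have h3 : 0 ≤ √(T * E) * √(T * Real.log T) := by positivity
    refine Real.sqrt_le_iff.2 ⟨by positivity, ?_⟩
    linarith [add_sq √(T * E) (2 * √(T * Real.log T)), mul_pow 2 √(T * Real.log T) 2]
  rw [e, Real.sqrt_mul (sq_nonneg _), Real.sqrt_sq (by positivity), Real.sqrt_mul zero_le_two]
  have := mul_le_mul_of_nonneg_left hsplit (show 0 ≤ 2 * l * √2 by positivity)
  linarith
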